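/- Corollary 3.5 (reverse Wiener matrix). Let $p\in(0,1)$ be a constant and let $G_p\in\mathcal G_{n,p}$ be the Erdős–Rényi random graph on $n$ vertices, in which each pair of distinct vertices is joined by an edge independently with probability $p$. For a connected graph $G$ with vertices $1,\dots,n$, graph distance $D(i,j)$ and diameter $\operatorname{diam}(G)=\max_{i,j}D(i,j)$, the reverse Wiener matrix $RW(G)$ is the real symmetric $n\times n$ matrix with entries $RW(G)(i,j)=\operatorname{diam}(G)-D(i,j)$ for $i\ne j$ and $RW(G)(i,i)=0$. The energy $\mathscr E(M)=\sum_{i=1}^n|\lambda_i|$ of a real symmetric matrix $M$ is the sum of the absolute values of its eigenvalues $\lambda_1,\dots,\lambda_n$, counted with multiplicity. Then $$\mathscr E(RW(G_p))=\Big(\frac{8}{3\pi}\sqrt{p(1-p)}+o(1)\Big)\,n^{3/2}\quad\text{a.s.},$$ where "a.s." means "with probability tending to $1$ as $n\to\infty$"; that is, for every $\varepsilon>0$, the probability that $G_p$ is connected (so that $RW(G_p)$ is defined) and $$\Big|\mathscr E(RW(G_p))-\frac{8}{3\pi}\sqrt{p(1-p)}\;n^{3/2}\Big|\le\varepsilon\,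 n^{3/2}$$ tends to $1$ as $n\to\infty$. -/

import Mathlib

/-- The energy of a real symmetric matrix: the sum of the absolute values of its eigenvalues,
counted with multiplicity. -/
noncomputable def matrixEnergy {V : Type*} [Fintype V] [DecidableEq V]
    {A : Matrix V V ℝ} (hA : A.IsHermitian) : ℝ :=
  ∑ i, |hA.eigenvalues i|

/-- The reverse Wiener matrix of a graph: its `ij`-entry is `diam(G) - D(i, j)` for `i ≠ j`, and
the diagonal vanishes. It is meant for connected graphs; on a finite connected graph
`SimpleGraph.diam` and `SimpleGraph.dist` are the diameter and the graph distance. -/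
noncomputable def reverseWienerMatrix {V : Type*} [DecidableEq V] (G : SimpleGraph V) :
    Matrix V V ℝ :=
  Matrix.of fun i j => if i = j then 0 else (G.diam : ℝ) - (G.dist i j : ℝ)

theorem reverseWienerMatrix_isHermitian {V : Type*} [DecidableEq V] (G : SimpleGraph V) :
    (reverseWienerMatrix G).IsHermitian := by
  ext i j
  simp [reverseWienerMatrix, eq_comm, SimpleGraph.dist_comm]

/-- The energy of the reverse Wiener matrix of a finite graph. -/
noncomputable def reverseWienerEnergy {V : Type*} [Fintype V] [DecidableEq V]
    (G : SimpleGraph V) : ℝ :=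
  matrixEnergy (reverseWienerMatrix_isHermitian G)

/-! With high probability the graph is not complete and any two vertices have a common neighbour.
Then the diameter is 2 and the reverse Wiener matrix is the adjacency matrix A, so only the energy
of A matters.

Coulson's formula |x| = (2/π) ∫₀^∞ x²/(x²+t²) dt turns the energy of A/√n into an integral of 1 - t
Im s(it), where s is the normalized trace of the resolvent. Put v = p(1-p). By the semicircle law s
= s(it) should nearly solve 1 + its + vs² = 0. The defect P of this equation satisfies E|P|² =
O(n^(-1/2)) for each fixed t (`exists_sum_binomialWeight_defect_le`): the centred entries a_ij - p
in conj(P)·P are removed by the exact integration by parts `sum_binomialWeight_centered_smul`, and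
the resulting edge differences are expanded by the resolvent identity. Keeping conj(P) in the test
function makes a separate concentration argument unnecessary. The mean of A only enters through the
sum of the off-diagonal resolvent entries, which is of order n.

Stability of the quadratic equation (`abs_im_sub_semicircleStieltjes_le`) makes the Coulson
integrand converge in mean for each t. Domination by 2/(1+t²) passes this to the integral, and
Markov's inequality gives convergence in probability. The limiting integrand has integral (4/3)√v
(`semicircle_integral`), and (2/π)(4/3) = 8/(3π). -/

set_option linter.unusedSectionVars false

/-! ### Operator norm bounds and the resolvent on the imaginary axis. -/

section Resolvent

open scoped Matrix.Norms.L2Operator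
open Matrix Complex

variable {V : Type*} [Fintype V] [DecidableEq V]

theorem norm_dotProduct_mulVec_le (M : Matrix V V ℂ) (x y : EuclideanSpace ℂ V) :
    ‖star x.ofLp ⬝ᵥ M *ᵥ y.ofLp‖ ≤ ‖M‖ * ‖x‖ * ‖y‖ := by
  have h : star x.ofLp ⬝ᵥ M *ᵥ y.ofLp = inner ℂ x (WithLp.toLp 2 (M *ᵥ y.ofLp)) := by
    rw [EuclideanSpace.inner_eq_star_dotProduct, dotProduct_comm]
  rw [h]
  calc _ ≤ ‖x‖ * ‖WithLp.toLp 2 (M *ᵥ y.ofLp)‖ := norm_inner_le_norm _ _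
    _ ≤ ‖x‖ * (‖M‖ * ‖y‖) := by gcongr; exact l2_opNorm_mulVec M y
    _ = _ := by ring

theorem norm_entry_le_l2_opNorm (M : Matrix V V ℂ) (i j : V) : ‖M i j‖ ≤ ‖M‖ := by
  have := norm_dotProduct_mulVec_le M (EuclideanSpace.single i 1) (EuclideanSpace.single j 1)
  simpa using this

/-- Pair with the all-ones vector, of squared norm n. The bound has order n where entrywise
estimates give n²; this is what makes the mean of the adjacency matrix harmless. -/
theorem norm_sum_entries_le (M : Matrix V V ℂ) :
    ‖∑ i, ∑ j, M i j‖ ≤ ‖M‖ * Fintype.card V := by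
  have h := norm_dotProduct_mulVec_le M (WithLp.toLp 2 fun _ => 1) (WithLp.toLp 2 fun _ => 1)
  have h1 : ‖(WithLp.toLp 2 fun _ => 1 : EuclideanSpace ℂ V)‖ ^ 2 = Fintype.card V := by
    simp [EuclideanSpace.norm_sq_eq]
  rw [mul_assoc, ← sq, h1] at h
  simpa [dotProduct, mulVec] using h

/-- The row sum is a diagonal entry of `M * Mᴴ`. -/
theorem sum_norm_sq_row_le (M : Matrix V V ℂ) (i : V) : ∑ j, ‖M i j‖ ^ 2 ≤ ‖M‖ ^ 2 := by
  have h := norm_entry_le_l2_opNorm (M * Mᴴ) i i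
  have h1 : (M * Mᴴ) i i = ((∑ j, ‖M i j‖ ^ 2 : ℝ) : ℂ) := by
    simp [mul_apply, Complex.mul_conj, Complex.normSq_eq_norm_sq]
  rw [h1, Complex.norm_real, Real.norm_of_nonneg (by positivity)] at h
  calc _ ≤ _ := h
    _ ≤ ‖M‖ * ‖Mᴴ‖ := norm_mul_le _ _
    _ = _ := by rw [l2_opNorm_conjTranspose, sq]

/-- The resolvent of the real matrix `c • A` at the point `t * I` of the imaginary axis. -/
noncomputable def imagResolvent (A : Matrix V V ℝ) (c t : ℝ) : Matrix V V ℂ :=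
  ((c : ℂ) • A.map Complex.ofReal - (t * I : ℂ) • 1)⁻¹

theorem ofReal_sub_mul_I_ne_zero (x : ℝ) {t : ℝ} (ht : 0 < t) : (x - t * I : ℂ) ≠ 0 := by
  intro h
  have := congrArg Complex.im h
  simp at this
  exact ht.ne' this

theorem norm_inv_ofReal_sub_mul_I_le (x : ℝ) {t : ℝ} (ht : 0 < t) :
    ‖(x - t * I : ℂ)⁻¹‖ ≤ 1 / t := by
  rw [norm_inv, ← one_div]
  gcongr
  have := Complex.abs_im_le_norm (x - t * I : ℂ)
  simpa [abs_of_pos ht] using this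

/-- A real orthonormal eigenbasis stays unitary over ℂ, and the shifted eigenvalues are nonzero
since `t > 0`. The last clause matters because the matrix inverse defaults to zero on singular
matrices. -/
theorem exists_unitary_diagonalization {A : Matrix V V ℝ} (hA : A.IsHermitian) (c : ℝ) {t : ℝ}
    (ht : 0 < t) : ∃ U ∈ unitaryGroup V ℂ,
      imagResolvent A c t =
        U * diagonal (fun i => ((c * hA.eigenvalues i : ℝ) - t * I : ℂ)⁻¹) * star U ∧
      ((c : ℂ) • A.map Complex.ofReal - (t * I : ℂ) • 1) * imagResolvent A c t = 1 := by
  set U : Matrix V V ℂ := (hA.eigenvectorUnitary : Matrix V V ℝ).map Complex.ofRealHom with hU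
  have hs : star U = (star (hA.eigenvectorUnitary : Matrix V V ℝ)).map Complex.ofRealHom := by
    ext i j; simp [hU, star_apply]
  have h1 : U * star U = 1 := by
    rw [hs, hU, ← Matrix.map_mul, Unitary.mul_star_self_of_mem hA.eigenvectorUnitary.2]
    simp
  have h2 : star U * U = 1 := by
    rw [hs, hU, ← Matrix.map_mul, Unitary.star_mul_self_of_mem hA.eigenvectorUnitary.2]
    simp
  have hUm : U ∈ unitaryGroup V ℂ := mem_unitaryGroup_iff.2 h1
  have hAd : A.map Complex.ofReal = U * diagonal (fun i => (hA.eigenvalues i : ℂ)) * star U := by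
    have h := hA.spectral_theorem
    rw [Unitary.conjStarAlgAut_apply] at h
    have h' := congrArg (fun M : Matrix V V ℝ => M.map Complex.ofRealHom) h
    simp only [Matrix.map_mul] at h'
    rw [hs, hU]
    refine h'.trans ?_
    congr 2
    ext i j
    by_cases hij : i = j <;> simp [hij, diagonal]
  have hd : (c : ℂ) • A.map Complex.ofReal - (t * I : ℂ) • 1 =
        U * diagonal (fun i => ((c * hA.eigenvalues i : ℝ) - t * I : ℂ)) * star U := by
    have e : diagonal (fun i => ((c * hA.eigenvalues i : ℝ) - t * I : ℂ)) =
        (c : ℂ) • diagonal (fun i => (hA.eigenvalues i : ℂ)) - (t * I : ℂ) • 1 := by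
      ext i j
      by_cases hij : i = j <;> simp [hij, diagonal, one_apply]
    rw [e, hAd, mul_sub, sub_mul, Matrix.mul_smul, Matrix.smul_mul, Matrix.mul_smul,
      Matrix.smul_mul, mul_one, h1]
  have key : ((c : ℂ) • A.map Complex.ofReal - (t * I : ℂ) • 1) *
      (U * diagonal (fun i => ((c * hA.eigenvalues i : ℝ) - t * I : ℂ)⁻¹) * star U) = 1 := by
    rw [hd]
    calc _ = U * diagonal (fun i => ((c * hA.eigenvalues i : ℝ) - t * I : ℂ)) * (star U * U) *
          diagonal (fun i => ((c * hA.eigenvalues i : ℝ) - t * I : ℂ)⁻¹) * star U := by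
          simp only [mul_assoc]
      _ = U * (diagonal (fun i => ((c * hA.eigenvalues i : ℝ) - t * I : ℂ)) *
          diagonal (fun i => ((c * hA.eigenvalues i : ℝ) - t * I : ℂ)⁻¹)) * star U := by
          rw [h2, mul_one, mul_assoc U]
      _ = 1 := by
          rw [diagonal_mul_diagonal]
          simp_rw [mul_inv_cancel₀ (ofReal_sub_mul_I_ne_zero _ ht)]
          rw [diagonal_one, mul_one, h1]
  have hR := inv_eq_right_inv key
  refine ⟨U, hUm, hR, ?_⟩
  rw [imagResolvent, hR, key]

theorem imagResolvent_norm_le {A : Matrix V V ℝ} (hA : A.IsHermitian) (c : ℝ) {t : ℝ}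
    (ht : 0 < t) : ‖imagResolvent A c t‖ ≤ 1 / t := by
  obtain ⟨U, hU, h, -⟩ := exists_unitary_diagonalization hA c ht
  have hU' : star U ∈ unitary (Matrix V V ℂ) := Unitary.star_mem hU
  rw [h, CStarRing.norm_mul_mem_unitary _ hU', CStarRing.norm_mem_unitary_mul _ hU,
    l2_opNorm_diagonal, pi_norm_le_iff_of_nonneg (by positivity)]
  exact fun i => norm_inv_ofReal_sub_mul_I_le _ ht

theorem trace_imagResolvent {A : Matrix V V ℝ} (hA : A.IsHermitian) (c : ℝ) {t : ℝ}
    (ht : 0 < t) :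
    (imagResolvent A c t).trace = ∑ i, ((c * hA.eigenvalues i : ℝ) - t * I : ℂ)⁻¹ := by
  obtain ⟨U, hU, h, -⟩ := exists_unitary_diagonalization hA c ht
  rw [h, trace_mul_comm, ← mul_assoc, mem_unitaryGroup_iff'.1 hU, one_mul, trace_diagonal]

theorem trace_imagResolvent_im {A : Matrix V V ℝ} (hA : A.IsHermitian) (c : ℝ) {t : ℝ}
    (ht : 0 < t) :
    (imagResolvent A c t).trace.im = ∑ i, t / ((c * hA.eigenvalues i) ^ 2 + t ^ 2) := by
  rw [trace_imagResolvent hA c ht, Complex.im_sum]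
  refine Finset.sum_congr rfl fun i _ => ?_
  simp [Complex.inv_im, Complex.normSq_apply, sq]

theorem imagResolvent_mul_cancel {A : Matrix V V ℝ} (hA : A.IsHermitian) (c : ℝ) {t : ℝ}
    (ht : 0 < t) :
    imagResolvent A c t * ((c : ℂ) • A.map Complex.ofReal - (t * I : ℂ) • 1) = 1 ∧
    ((c : ℂ) • A.map Complex.ofReal - (t * I : ℂ) • 1) * imagResolvent A c t = 1 := by
  obtain ⟨U, hU, -, key⟩ := exists_unitary_diagonalization hA c ht
  exact ⟨mul_eq_one_comm.1 key, key⟩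

/-- The resolvent identity. -/
theorem imagResolvent_sub {A B : Matrix V V ℝ} (hA : A.IsHermitian) (hB : B.IsHermitian) (c : ℝ)
    {t : ℝ} (ht : 0 < t) :
    imagResolvent A c t - imagResolvent B c t =
      -(c : ℂ) • (imagResolvent A c t * (A - B).map Complex.ofReal * imagResolvent B c t) := by
  have h1 := (imagResolvent_mul_cancel hA c ht).1
  have h2 := (imagResolvent_mul_cancel hB c ht).2
  set R := imagResolvent A c t
  set S := imagResolvent B c t
  have e : (A - B).map Complex.ofReal = A.map Complex.ofReal - B.map Complex.ofReal := by
    ext; simp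
  set A' := A.map Complex.ofReal
  set B' := B.map Complex.ofReal
  calc R - S = R * (((c : ℂ) • B' - (t * I : ℂ) • 1) * S) -
        (R * ((c : ℂ) • A' - (t * I : ℂ) • 1)) * S := by rw [h1, h2, mul_one, one_mul]
    _ = _ := by
      rw [e]
      simp only [mul_sub, sub_mul, Matrix.mul_smul, Matrix.smul_mul, smul_sub, neg_smul, mul_one, one_mul,
        mul_assoc]
      abel

end Resolvent

/-! ### Weights of the binomial random graph and integration by parts in one edge. -/

section BinomialWeights

open SimpleGraph MeasureTheory

variable {V : Type*}

open Classical in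
/-- The real adjacency matrix of a graph, with classical decidability. -/
noncomputable def realAdjMatrix (G : SimpleGraph V) : Matrix V V ℝ := G.adjMatrix ℝ

theorem realAdjMatrix_of_adj {G : SimpleGraph V} {i j : V} (h : G.Adj i j) :
    realAdjMatrix G i j = 1 := by
  simp [realAdjMatrix, h]

theorem realAdjMatrix_of_not_adj {G : SimpleGraph V} {i j : V} (h : ¬ G.Adj i j) :
    realAdjMatrix G i j = 0 := by
  simp [realAdjMatrix, h]

theorem realAdjMatrix_isHermitian (G : SimpleGraph V) : (realAdjMatrix G).IsHermitian := by
  classical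
  ext i j
  simp [realAdjMatrix, adjMatrix_apply, G.adj_comm]

variable [Fintype V] [DecidableEq V] (p : unitInterval)

/-- The probability of a graph under the binomial random graph distribution. -/
noncomputable def binomialWeight (G : SimpleGraph V) : ℝ := (binomialRandom V p).real {G}

theorem binomialWeight_eq (G : SimpleGraph V) :
    binomialWeight p G = (p : ℝ) ^ G.edgeSet.ncard *
      (1 - p : ℝ) ^ ((Nat.card V).choose 2 - G.edgeSet.ncard) := by
  simp [binomialWeight, measureReal_def]

theorem binomialWeight_nonneg (G : SimpleGraph V) : 0 ≤ binomialWeight p G :=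
  measureReal_nonneg

instance : MeasurableSingletonClass (SimpleGraph V) where
  measurableSet_singleton G := by
    rw [← measurableEmbedding_edgeSet.measurableSet_image, Set.image_singleton]
    exact measurableSet_singleton _

theorem binomialRandom_real_eq_sum (S : Set (SimpleGraph V)) [DecidablePred (· ∈ S)] :
    (binomialRandom V p).real S = ∑ G with G ∈ S, binomialWeight p G := by
  have := sum_measureReal_singleton (μ := binomialRandom V p) (Finset.univ.filter (· ∈ S))
  simp only [Finset.coe_filter, Finset.mem_univ, true_and] at this
  exact this.symm

theorem sum_binomialWeight : ∑ G : SimpleGraph V, binomialWeight p G = 1 := by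
  classical
  have := binomialRandom_real_eq_sum p (Set.univ : Set (SimpleGraph V))
  simpa using this.symm

theorem binomialRandom_real_le_sum (S : Set (SimpleGraph V)) (f : SimpleGraph V → ℝ)
    (hf : ∀ G, 0 ≤ f G) (hS : ∀ G ∈ S, 1 ≤ f G) :
    (binomialRandom V p).real S ≤ ∑ G, binomialWeight p G * f G := by
  classical
  rw [binomialRandom_real_eq_sum, Finset.sum_filter]
  refine Finset.sum_le_sum fun G _ => ?_
  have := binomialWeight_nonneg p G
  split_ifs with h
  · nlinarith [hS G h]
  · exact mul_nonneg this (hf G)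

theorem binomialWeight_sup_edge {G : SimpleGraph V} {i j : V} (hij : i ≠ j) (h : ¬ G.Adj i j) :
    binomialWeight p (G ⊔ edge i j) * (1 - p) = p * binomialWeight p G := by
  classical
  have h1 : (G ⊔ edge i j).edgeSet.ncard = G.edgeSet.ncard + 1 := by
    have := card_edgeFinset_sup_edge G h hij
    rwa [← Set.ncard_coe_finset, ← Set.ncard_coe_finset, coe_edgeFinset, coe_edgeFinset] at this
  -- This bound makes the truncated subtraction in the exponent of `1 - p` a genuine one.
  have h2 : (G ⊔ edge i j).edgeSet.ncard ≤ (Nat.card V).choose 2 := by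
    have := (G ⊔ edge i j).card_edgeFinset_le_card_choose_two
    rwa [← Set.ncard_coe_finset, coe_edgeFinset, ← Nat.card_eq_fintype_card] at this
  rw [binomialWeight_eq, binomialWeight_eq, h1]
  rw [h1] at h2
  obtain ⟨k, hk⟩ := Nat.exists_eq_add_of_le h2
  have e1 : (Nat.card V).choose 2 - (G.edgeSet.ncard + 1) = k := by omega
  have e2 : (Nat.card V).choose 2 - G.edgeSet.ncard = k + 1 := by omega
  rw [e1, e2]
  ring

variable {E : Type*} [AddCommGroup E] [Module ℝ E]

/-- Integration by parts for one edge indicator of the binomial random graph. -/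
theorem sum_binomialWeight_centered_smul {i j : V} (hij : i ≠ j) (f : SimpleGraph V → E) :
    ∑ G, binomialWeight p G • (realAdjMatrix G i j - p) • f G =
      (p * (1 - p) : ℝ) • ∑ G, binomialWeight p G • (f (G ⊔ edge i j) - f (G \ edge i j)) := by
  classical
  -- Toggling the edge is an involution. The identity is checked on each pair `G`, `T G`; summing
  -- over all graphs then counts it twice, whence the factor 2 cancelled at the end.
  set T : SimpleGraph V → SimpleGraph V := fun G => symmDiff G (edge i j) with hT
  have hTi : Function.Involutive T := fun G => by simp [hT]
  set Φ : SimpleGraph V → E := fun G => binomialWeight p G • (realAdjMatrix G i j - p : ℝ) • f G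
  set Ψ : SimpleGraph V → E := fun G =>
    (p * (1 - p) : ℝ) • binomialWeight p G • (f (G ⊔ edge i j) - f (G \ edge i j))
  have hreidx : ∀ F : SimpleGraph V → E, ∑ G, F (T G) = ∑ G, F G := fun F =>
    (Equiv.sum_comp hTi.toPerm F)
  have key' : ∀ G, ¬ G.Adj i j → Φ G + Φ (T G) = Ψ G + Ψ (T G) := by
    intro G h
    have hTG : T G = G ⊔ edge i j := ((disjoint_edge G).2 h).symmDiff_eq_sup
    have hadj : (G ⊔ edge i j).Adj i j := by simp [edge_adj, hij]
    have hw := binomialWeight_sup_edge p hij h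
    have hsd : (G ⊔ edge i j) \ edge i j = G := by
      rw [sup_sdiff_right_self, sdiff_edge _ h]
    simp only [Φ, Ψ, hTG, realAdjMatrix_of_adj hadj, realAdjMatrix_of_not_adj h, hsd,
      sdiff_edge _ h, sup_assoc, sup_idem]
    linear_combination (norm := module) ((1 - p : ℝ) * hw) • f (G ⊔ edge i j) + ((p : ℝ) * hw) • f G
  have key : ∀ G, Φ G + Φ (T G) = Ψ G + Ψ (T G) := by
    intro G
    by_cases h : G.Adj i j
    · have h' : ¬ (T G).Adj i j := by
        have : T G = G \ edge i j := symmDiff_of_ge ((edge_le_iff _).2 (Or.inr h))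
        rw [this]
        simp [edge_adj, hij]
      have := key' (T G) h'
      rw [hTi G] at this
      rw [add_comm, this, add_comm]
    · exact key' G h
  have hsum := Finset.sum_congr rfl fun G (_ : G ∈ Finset.univ) => key G
  simp only [Finset.sum_add_distrib, hreidx] at hsum
  have h2 : (2 : ℝ) • ∑ G, Φ G = (2 : ℝ) • ∑ G, Ψ G := by
    rw [two_smul, two_smul]; exact hsum
  rw [Finset.smul_sum]
  exact smul_right_injective E (two_ne_zero (α := ℝ)) h2

/-- Independence of an edge from the rest of the graph: the difference term of the integration by
parts vanishes. -/
theorem sum_binomialWeight_adj_smul {i j : V} (hij : i ≠ j) (f : SimpleGraph V → E)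
    (hf : ∀ G, f (G ⊔ edge i j) = f (G \ edge i j)) :
    ∑ G, binomialWeight p G • realAdjMatrix G i j • f G =
      (p : ℝ) • ∑ G, binomialWeight p G • f G := by
  have h := sum_binomialWeight_centered_smul p hij f
  simp only [hf, sub_self, smul_zero, Finset.sum_const_zero, sub_smul, smul_sub,
    Finset.sum_sub_distrib, sub_eq_zero] at h
  rw [h, Finset.smul_sum]
  exact Finset.sum_congr rfl fun G _ => smul_comm _ _ _

end BinomialWeights

/-! ### Diameter two with high probability. -/

section DiameterTwo

open SimpleGraph MeasureTheory Filter Topology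

variable {V : Type*}

/-- The graph is not complete and any two distinct vertices have a common neighbour. -/
def HasDiameterTwo (G : SimpleGraph V) : Prop :=
  G ≠ ⊤ ∧ ∀ i j, i ≠ j → ∃ k, G.Adj i k ∧ G.Adj j k

theorem HasDiameterTwo.connected {G : SimpleGraph V} (h : HasDiameterTwo G) : G.Connected := by
  have : Nonempty V := by
    by_contra hV
    rw [not_nonempty_iff] at hV
    exact h.1 (Subsingleton.elim _ _)
  refine ⟨fun i j => ?_⟩
  by_cases hij : i = j
  · rw [hij]
  · obtain ⟨k, h1, h2⟩ := h.2 i j hij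
    exact h1.reachable.trans h2.symm.reachable

theorem HasDiameterTwo.dist_eq {G : SimpleGraph V} (h : HasDiameterTwo G) {i j : V}
    (hij : i ≠ j) (hadj : ¬ G.Adj i j) : G.dist i j = 2 := by
  obtain ⟨k, h1, h2⟩ := h.2 i j hij
  have hle : G.dist i j ≤ 2 := dist_le (Walk.cons h1 (Walk.cons h2.symm Walk.nil))
  have h0 : G.dist i j ≠ 0 := fun h0 => hij ((h.connected.dist_eq_zero_iff).1 h0)
  have h1' : G.dist i j ≠ 1 := fun h1 => hadj (dist_eq_one_iff_adj.1 h1)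
  omega

theorem HasDiameterTwo.diam_eq [Finite V] {G : SimpleGraph V} (h : HasDiameterTwo G) :
    G.diam = 2 := by
  have : Nonempty V := h.connected.nonempty
  apply le_antisymm
  · obtain ⟨u, v, huv⟩ := G.exists_dist_eq_diam
    rw [← huv]
    by_cases e : u = v
    · simp [e]
    · by_cases hadj : G.Adj u v
      · rw [dist_eq_one_iff_adj.2 hadj]; norm_num
      · exact (h.dist_eq e hadj).le
  · obtain ⟨i, j, hij, hadj⟩ : ∃ i j, i ≠ j ∧ ¬ G.Adj i j := by
      by_contra! hc
      exact h.1 (by ext i j; exact ⟨fun a => a.ne, fun a => hc i j a⟩)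
    rw [← h.dist_eq hij hadj]
    exact dist_le_diam (connected_iff_ediam_ne_top.1 h.connected)

theorem HasDiameterTwo.reverseWienerMatrix_eq [Finite V] [DecidableEq V] {G : SimpleGraph V}
    (h : HasDiameterTwo G) : reverseWienerMatrix G = realAdjMatrix G := by
  ext i j
  by_cases hij : i = j
  · subst hij
    rw [realAdjMatrix_of_not_adj (G.irrefl)]
    simp [reverseWienerMatrix]
  · by_cases hadj : G.Adj i j
    · rw [realAdjMatrix_of_adj hadj]
      simp [reverseWienerMatrix, hij, h.diam_eq, dist_eq_one_iff_adj.2 hadj]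
      norm_num
    · rw [realAdjMatrix_of_not_adj hadj]
      simp [reverseWienerMatrix, hij, h.diam_eq, h.dist_eq hij hadj]

theorem realAdjMatrix_sup_edge_eq (G : SimpleGraph V) {i k a b : V} (h : s(i, k) ≠ s(a, b)) :
    realAdjMatrix (G ⊔ edge i k) a b = realAdjMatrix (G \ edge i k) a b := by
  have h' : ¬ (edge i k).Adj a b := fun hc => h ((adj_edge _ _).1 hc).1
  by_cases hG : G.Adj a b
  · rw [realAdjMatrix_of_adj (by simp [hG]), realAdjMatrix_of_adj (by simp [hG, h'])]
  · rw [realAdjMatrix_of_not_adj (by simp [hG, h']), realAdjMatrix_of_not_adj (by simp [hG])]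

variable [Fintype V] [DecidableEq V] (p : unitInterval)

/-- Distinct `k` involve disjoint pairs of edges, so the factors are independent. The induction
integrates out the edges `ik` and `jk` one after the other, each contributing `p`. -/
theorem sum_binomialWeight_prod_codegree {i j : V} (hij : i ≠ j) (S : Finset V) (hi : i ∉ S)
    (hj : j ∉ S) :
    ∑ G, binomialWeight p G * ∏ k ∈ S, (1 - realAdjMatrix G i k * realAdjMatrix G j k) =
      (1 - p ^ 2 : ℝ) ^ S.card := by
  induction S using Finset.induction_on with
  | empty => simp [sum_binomialWeight]
  | insert k S hk ih =>
    simp only [Finset.mem_insert, not_or] at hi hj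
    specialize ih hi.2 hj.2
    rw [Finset.card_insert_of_notMem hk, pow_succ, ← ih]
    set F : SimpleGraph V → ℝ := fun G =>
      ∏ l ∈ S, (1 - realAdjMatrix G i l * realAdjMatrix G j l) with hF
    have hFe : ∀ u, (u = i ∨ u = j) → ∀ G, F (G ⊔ edge u k) = F (G \ edge u k) := by
      intro u hu G
      refine Finset.prod_congr rfl fun l hl => ?_
      have h1 : l ≠ k := fun e => hk (e ▸ hl)
      have h2 : l ≠ i := fun e => hi.2 (e ▸ hl)
      have h3 : l ≠ j := fun e => hj.2 (e ▸ hl)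
      rw [realAdjMatrix_sup_edge_eq, realAdjMatrix_sup_edge_eq] <;>
      · rw [Ne, Sym2.eq_iff]
        rintro (⟨_, e⟩ | ⟨e, _⟩) <;> rcases hu with rfl | rfl <;> simp_all
    have e1 := sum_binomialWeight_adj_smul p hi.1 (fun G => realAdjMatrix G j k * F G) (fun G => by
      rw [hFe i (Or.inl rfl), realAdjMatrix_sup_edge_eq]
      rw [Ne, Sym2.eq_iff]
      rintro (⟨e, _⟩ | ⟨e, _⟩) <;> simp_all)
    have e2 := sum_binomialWeight_adj_smul p hj.1 F (hFe j (Or.inr rfl))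
    simp only [smul_eq_mul] at e1 e2
    rw [e2] at e1
    calc _ = ∑ G, (binomialWeight p G * F G -
          binomialWeight p G * (realAdjMatrix G i k * (realAdjMatrix G j k * F G))) := by
          refine Finset.sum_congr rfl fun G _ => ?_
          rw [Finset.prod_insert hk]
          ring
      _ = _ := by
          rw [Finset.sum_sub_distrib, e1]
          ring

theorem realAdjMatrix_nonneg (G : SimpleGraph V) (i j : V) : 0 ≤ realAdjMatrix G i j := by
  by_cases h : G.Adj i j
  · simp [realAdjMatrix_of_adj h]
  · simp [realAdjMatrix_of_not_adj h]

theorem realAdjMatrix_le_one (G : SimpleGraph V) (i j : V) : realAdjMatrix G i j ≤ 1 := by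
  by_cases h : G.Adj i j
  · simp [realAdjMatrix_of_adj h]
  · simp [realAdjMatrix_of_not_adj h]

theorem binomialRandom_real_no_common_neighbor_le {i j : V} (hij : i ≠ j) :
    (binomialRandom V p).real {G | ¬ ∃ k, G.Adj i k ∧ G.Adj j k} ≤
      (1 - p ^ 2 : ℝ) ^ (Fintype.card V - 2) := by
  have hcard : ((Finset.univ.erase i).erase j).card = Fintype.card V - 2 := by
    rw [Finset.card_erase_of_mem (by simp [hij.symm]), Finset.card_erase_of_mem (by simp),
      Finset.card_univ]
    omega
  rw [← hcard, ← sum_binomialWeight_prod_codegree p hij _ (by simp) (by simp)]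
  refine binomialRandom_real_le_sum p _ _ (fun G => ?_) (fun G hG => ?_)
  · refine Finset.prod_nonneg fun k _ => ?_
    nlinarith [realAdjMatrix_nonneg G i k, realAdjMatrix_nonneg G j k, realAdjMatrix_le_one G i k,
      realAdjMatrix_le_one G j k]
  · refine (Finset.prod_eq_one fun k _ => ?_).ge
    by_cases h1 : G.Adj i k
    · have h2 : ¬ G.Adj j k := fun h2 => hG ⟨k, h1, h2⟩
      simp [realAdjMatrix_of_not_adj h2]
    · simp [realAdjMatrix_of_not_adj h1]

theorem binomialWeight_top :
    binomialWeight p (⊤ : SimpleGraph V) = (p : ℝ) ^ (Fintype.card V).choose 2 := by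
  have h : (⊤ : SimpleGraph V).edgeSet.ncard = (Fintype.card V).choose 2 := by
    rw [← card_edgeFinset_top_eq_card_choose_two, ← Set.ncard_coe_finset, coe_edgeFinset]
  rw [binomialWeight_eq, h, Nat.card_eq_fintype_card]
  simp

/-- Union bound over ordered pairs of vertices. The complete graph, whose diameter is not 2, is
counted separately. -/
theorem binomialRandom_real_not_hasDiameterTwo_le :
    (binomialRandom V p).real {G | ¬ HasDiameterTwo G} ≤
      (p : ℝ) ^ (Fintype.card V).choose 2 +
        (Fintype.card V : ℝ) ^ 2 * (1 - p ^ 2 : ℝ) ^ (Fintype.card V - 2) := by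
  have hp : (0 : ℝ) ≤ 1 - p ^ 2 := by
    have h0 := p.2.1
    have h1 := p.2.2
    nlinarith
  set q := (1 - p ^ 2 : ℝ) ^ (Fintype.card V - 2) with hq
  set B : V × V → Set (SimpleGraph V) := fun e =>
    {G | e.1 ≠ e.2 ∧ ¬ ∃ k, G.Adj e.1 k ∧ G.Adj e.2 k} with hB
  have hsub : {G : SimpleGraph V | ¬ HasDiameterTwo G} ⊆
      {⊤} ∪ ⋃ e ∈ (Finset.univ : Finset (V × V)), B e := by
    intro G hG
    by_cases hT : G = ⊤
    · exact Or.inl hT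
    · right
      simp only [Set.mem_ofPred_eq, HasDiameterTwo, not_and, not_forall] at hG
      obtain ⟨i, j, hij, h⟩ := hG hT
      simp only [Finset.mem_univ, Set.iUnion_true, Set.mem_iUnion]
      exact ⟨(i, j), hij, h⟩
  calc _ ≤ _ := measureReal_mono hsub
    _ ≤ (binomialRandom V p).real {⊤} +
        (binomialRandom V p).real (⋃ e ∈ (Finset.univ : Finset (V × V)), B e) :=
        measureReal_union_le _ _
    _ ≤ (p : ℝ) ^ (Fintype.card V).choose 2 +
        ∑ e : V × V, (binomialRandom V p).real (B e) := by
        gcongr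
        · exact (binomialWeight_top p).le
        · exact measureReal_biUnion_finset_le _ _
    _ ≤ (p : ℝ) ^ (Fintype.card V).choose 2 + ∑ e : V × V, q := by
        gcongr with e
        by_cases he : e.1 = e.2
        · have : B e = ∅ := by ext; simp [hB, he]
          rw [this, measureReal_empty]
          positivity
        · refine le_trans (measureReal_mono ?_) (binomialRandom_real_no_common_neighbor_le p he)
          exact fun G hG => hG.2
    _ = _ := by
        simp [Fintype.card_prod, sq]

theorem tendsto_binomialRandom_real_not_hasDiameterTwo (hp0 : 0 < (p : ℝ)) (hp1 : (p : ℝ) < 1) :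
    Tendsto (fun n : ℕ => (binomialRandom (Fin n) p).real {G | ¬ HasDiameterTwo G})
      atTop (𝓝 0) := by
  have hq0 : (0 : ℝ) ≤ 1 - p ^ 2 := by nlinarith
  have hq1 : (1 : ℝ) - p ^ 2 < 1 := by nlinarith
  have h1 : Tendsto (fun n : ℕ => (p : ℝ) ^ n.choose 2) atTop (𝓝 0) := by
    refine (tendsto_pow_atTop_nhds_zero_of_lt_one hp0.le hp1).comp ?_
    refine tendsto_atTop_mono (f := fun n => n - 1) (fun n => ?_) (tendsto_sub_atTop_nat 1)
    rcases n with _ | m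
    · simp
    · simp [Nat.choose_succ_succ']
  have h2 : Tendsto (fun n : ℕ => (n : ℝ) ^ 2 * (1 - p ^ 2 : ℝ) ^ (n - 2)) atTop (𝓝 0) := by
    have hq : (0 : ℝ) < 1 - p ^ 2 := by nlinarith
    have h := (tendsto_pow_const_mul_const_pow_of_lt_one 2 hq0 hq1).const_mul
      ((1 - p ^ 2 : ℝ) ^ 2)⁻¹
    rw [mul_zero] at h
    refine h.congr' ?_
    filter_upwards [eventually_ge_atTop 2] with n hn
    obtain ⟨m, rfl⟩ := Nat.exists_eq_add_of_le hn
    rw [Nat.add_sub_cancel_left, pow_add (1 - p ^ 2 : ℝ) 2 m]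
    field_simp
  have h := h1.add h2
  rw [add_zero] at h
  refine squeeze_zero (fun n => measureReal_nonneg) (fun n => ?_) h
  simpa using binomialRandom_real_not_hasDiameterTwo_le (V := Fin n) p

end DiameterTwo

/-! ### Effect of one edge on the resolvent and on its trace. -/

section SelfConsistent

open SimpleGraph Matrix Complex ComplexConjugate
open scoped Matrix.Norms.L2Operator

variable {V : Type*} [Fintype V] [DecidableEq V]

/-- The resolvent at `t * I` of the adjacency matrix divided by the square root of its size. -/
noncomputable def graphResolvent (t : ℝ) (G : SimpleGraph V) : Matrix V V ℂ :=
  imagResolvent (realAdjMatrix G) (√(Fintype.card V))⁻¹ t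

/-- The Stieltjes transform at `t * I` of the normalized empirical spectral distribution. -/
noncomputable def graphStieltjes (t : ℝ) (G : SimpleGraph V) : ℂ :=
  (graphResolvent t G).trace / Fintype.card V

/-- The defect in the quadratic equation of the Stieltjes transform of the semicircle law. -/
noncomputable def semicircleDefect (v t : ℝ) (s : ℂ) : ℂ := 1 + t * I * s + v * s ^ 2

variable {t : ℝ}

theorem graphResolvent_norm_le (ht : 0 < t) (G : SimpleGraph V) :
    ‖graphResolvent t G‖ ≤ 1 / t :=
  imagResolvent_norm_le (realAdjMatrix_isHermitian G) _ ht

theorem graphResolvent_apply_norm_le (ht : 0 < t) (G : SimpleGraph V) (i j : V) :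
    ‖graphResolvent t G i j‖ ≤ 1 / t :=
  (norm_entry_le_l2_opNorm _ i j).trans (graphResolvent_norm_le ht G)

theorem graphStieltjes_norm_le (ht : 0 < t) (G : SimpleGraph V) :
    ‖graphStieltjes t G‖ ≤ 1 / t := by
  rw [graphStieltjes, norm_div, Complex.norm_natCast]
  rcases Nat.eq_zero_or_pos (Fintype.card V) with h | h
  · rw [h]; simp [ht.le]
  · have hn : (0 : ℝ) < Fintype.card V := by exact_mod_cast h
    rw [div_le_iff₀ hn]
    calc _ ≤ ∑ i, ‖graphResolvent t G i i‖ := norm_sum_le _ _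
      _ ≤ ∑ _i : V, 1 / t := Finset.sum_le_sum fun i _ => graphResolvent_apply_norm_le ht G i i
      _ = _ := by simp [mul_comm]

/-- Adding the edge changes the adjacency matrix by two matrix units, so the resolvent identity
collapses to two products of entries. -/
theorem graphResolvent_sub_apply (ht : 0 < t) (G : SimpleGraph V) {i j : V} (hij : i ≠ j)
    (a b : V) :
    graphResolvent t (G ⊔ edge i j) a b - graphResolvent t (G \ edge i j) a b =
      -((√(Fintype.card V))⁻¹ : ℝ) *
        (graphResolvent t (G ⊔ edge i j) a i * graphResolvent t (G \ edge i j) j b +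
          graphResolvent t (G ⊔ edge i j) a j * graphResolvent t (G \ edge i j) i b) := by
  have h := congrFun (congrFun (imagResolvent_sub (realAdjMatrix_isHermitian (G ⊔ edge i j))
    (realAdjMatrix_isHermitian (G \ edge i j)) (√(Fintype.card V))⁻¹ ht) a) b
  have hE : (realAdjMatrix (G ⊔ edge i j) - realAdjMatrix (G \ edge i j)).map Complex.ofReal =
      single i j (1 : ℂ) + single j i (1 : ℂ) := by
    ext x y
    simp only [map_apply, Matrix.sub_apply, Matrix.add_apply]
    by_cases hxy : s(i, j) = s(x, y)
    · rw [Sym2.eq_iff] at hxy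
      rcases hxy with ⟨rfl, rfl⟩ | ⟨rfl, rfl⟩
      · rw [realAdjMatrix_of_adj (by simp [edge_adj, hij]),
          realAdjMatrix_of_not_adj (by simp [edge_adj, hij])]
        simp [hij]
      · rw [realAdjMatrix_of_adj (by simp [edge_adj, hij, hij.symm]),
          realAdjMatrix_of_not_adj (by simp [edge_adj, hij, hij.symm])]
        simp [hij]
    · rw [realAdjMatrix_sup_edge_eq G hxy, sub_self]
      rw [Sym2.eq_iff, not_or] at hxy
      simp [hxy.1, and_comm (a := j = x), hxy.2]
  rw [hE] at h
  rw [Matrix.sub_apply] at h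
  refine h.trans ?_
  simp [mul_add, add_mul, mul_apply, single_apply, graphResolvent, ite_and]

theorem graphResolvent_sub_apply_norm_le (ht : 0 < t) (G : SimpleGraph V) {i j : V} (hij : i ≠ j)
    (a b : V) :
    ‖graphResolvent t (G ⊔ edge i j) a b - graphResolvent t (G \ edge i j) a b‖ ≤
      2 * (√(Fintype.card V))⁻¹ / t ^ 2 := by
  rw [graphResolvent_sub_apply ht G hij]
  have hr := graphResolvent_apply_norm_le (V := V) ht
  rw [norm_mul, norm_neg, Complex.norm_real, Real.norm_of_nonneg (by positivity)]
  calc _ ≤ (√(Fintype.card V))⁻¹ * (1 / t * (1 / t) + 1 / t * (1 / t)) := by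
        gcongr
        refine (norm_add_le _ _).trans ?_
        rw [norm_mul, norm_mul]
        gcongr <;> exact hr _ _ _
    _ = _ := by field_simp; ring

/-- Summing over the diagonal turns the products of entries into two entries of `S * R`, bounded by
the operator norm. This gains a factor 1/n over averaging the entrywise bound. -/
theorem graphStieltjes_sub_norm_le (ht : 0 < t) (G : SimpleGraph V) {i j : V} (hij : i ≠ j) :
    ‖graphStieltjes t (G ⊔ edge i j) - graphStieltjes t (G \ edge i j)‖ ≤
      2 * (√(Fintype.card V))⁻¹ / (Fintype.card V * t ^ 2) := by
  set c : ℝ := (√(Fintype.card V))⁻¹ with hc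
  set R := graphResolvent t (G ⊔ edge i j) with hR
  set S := graphResolvent t (G \ edge i j) with hS
  have hn : (0 : ℝ) < Fintype.card V := by
    exact_mod_cast Fintype.card_pos_iff.2 ⟨i⟩
  have htr : R.trace - S.trace = -(c : ℂ) * ((S * R) j i + (S * R) i j) := by
    simp only [trace, diag_apply, ← Finset.sum_sub_distrib]
    rw [Finset.sum_congr rfl fun a _ => graphResolvent_sub_apply ht G hij a a, ← Finset.mul_sum,
      Finset.sum_add_distrib, mul_apply, mul_apply]
    simp only [hR, hS, hc, mul_comm]
  have hb : ∀ a b, ‖(S * R) a b‖ ≤ 1 / t ^ 2 := fun a b => by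
    calc _ ≤ ‖S * R‖ := norm_entry_le_l2_opNorm _ _ _
      _ ≤ ‖S‖ * ‖R‖ := norm_mul_le _ _
      _ ≤ 1 / t * (1 / t) := by
          gcongr <;> exact graphResolvent_norm_le ht _
      _ = _ := by field_simp
  have hc0 : 0 ≤ c := by positivity
  rw [graphStieltjes, graphStieltjes, ← sub_div, htr, norm_div, norm_mul, norm_neg,
    Complex.norm_real, Real.norm_of_nonneg hc0, Complex.norm_natCast]
  calc _ ≤ c * (1 / t ^ 2 + 1 / t ^ 2) / Fintype.card V := by
        gcongr
        exact (norm_add_le _ _).trans (add_le_add (hb _ _) (hb _ _))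
    _ = _ := by field_simp; ring

theorem semicircleDefect_norm_le (ht : 0 < t) {v : ℝ} (hv0 : 0 ≤ v) (hv1 : v ≤ 1) {s : ℂ}
    (hs : ‖s‖ ≤ 1 / t) : ‖semicircleDefect v t s‖ ≤ 2 + 1 / t ^ 2 := by
  rw [semicircleDefect]
  calc _ ≤ ‖(1 : ℂ)‖ + ‖t * I * s‖ + ‖v * s ^ 2‖ := norm_add₃_le
    _ = 1 + t * ‖s‖ + v * ‖s‖ ^ 2 := by
        simp [abs_of_pos ht, abs_of_nonneg hv0]
    _ ≤ 1 + t * (1 / t) + 1 * (1 / t) ^ 2 := by gcongr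
    _ = _ := by field_simp; ring

theorem semicircleDefect_sub_norm_le (ht : 0 < t) {v : ℝ} (hv0 : 0 ≤ v) (hv1 : v ≤ 1) {s r : ℂ}
    (hs : ‖s‖ ≤ 1 / t) (hr : ‖r‖ ≤ 1 / t) :
    ‖semicircleDefect v t s - semicircleDefect v t r‖ ≤ ‖s - r‖ * (t + 2 / t) := by
  have : semicircleDefect v t s - semicircleDefect v t r = (s - r) * (t * I + v * (s + r)) := by
    simp only [semicircleDefect]; ring
  rw [this, norm_mul]
  gcongr
  calc _ ≤ ‖(t * I : ℂ)‖ + ‖v * (s + r)‖ := norm_add_le _ _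
    _ = t + v * ‖s + r‖ := by simp [abs_of_pos ht, abs_of_nonneg hv0]
    _ ≤ t + 1 * (1 / t + 1 / t) := by
        gcongr
        exact (norm_add_le _ _).trans (add_le_add hs hr)
    _ = _ := by ring

theorem sum_graphResolvent_eq (ht : 0 < t) (G : SimpleGraph V) :
    (((√(Fintype.card V))⁻¹ : ℝ) : ℂ) * ∑ i, ∑ j, realAdjMatrix G i j * graphResolvent t G j i =
      Fintype.card V + t * I * (graphResolvent t G).trace := by
  have h := (imagResolvent_mul_cancel (realAdjMatrix_isHermitian G) (√(Fintype.card V))⁻¹ ht).2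
  have h' := congrArg trace h
  rw [sub_mul, trace_sub, Matrix.smul_mul, Matrix.smul_mul, one_mul, trace_smul, trace_smul,
    trace_one, sub_eq_iff_eq_add] at h'
  simpa [trace, mul_apply, graphResolvent] using h'

theorem mul_sub_mul_add_norm_le {x y z u : ℂ} {B δ : ℝ} (hy : ‖y‖ ≤ B) (hz : ‖z‖ ≤ B)
    (hx : ‖x - z‖ ≤ δ) (hu : ‖y - u‖ ≤ δ) : ‖x * y - z * u‖ ≤ 2 * (δ * B) := by
  have e : x * y - z * u = (x - z) * y + z * (y - u) := by ring
  have hδ : 0 ≤ δ := (norm_nonneg _).trans hx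
  have hB : 0 ≤ B := (norm_nonneg _).trans hy
  rw [e]
  refine (norm_add_le _ _).trans ?_
  rw [norm_mul, norm_mul]
  calc _ ≤ δ * B + B * δ := by gcongr
    _ = _ := by ring

theorem eq_sup_edge_or_eq_sdiff_edge (G : SimpleGraph V) (i j : V) :
    G = G ⊔ edge i j ∨ G = G \ edge i j := by
  by_cases h : G.Adj i j
  · exact Or.inl (sup_edge_of_adj _ h).symm
  · exact Or.inr (sdiff_edge _ h).symm

/-- If a function differs by at most `δ` on the two graphs that agree with `G` away from an edge,
then it differs by at most `δ` between either of them and `G`. -/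
theorem norm_edge_sub_self_le {E : Type*} [SeminormedAddCommGroup E] {f : SimpleGraph V → E}
    {G : SimpleGraph V} {i j : V} {δ : ℝ}
    (h : ‖f (G ⊔ edge i j) - f (G \ edge i j)‖ ≤ δ) :
    ‖f (G ⊔ edge i j) - f G‖ ≤ δ ∧ ‖f (G \ edge i j) - f G‖ ≤ δ := by
  have hδ : 0 ≤ δ := (norm_nonneg _).trans h
  rcases eq_sup_edge_or_eq_sdiff_edge G i j with e | e
  · rw [← e] at h ⊢
    exact ⟨by simpa using hδ, by rwa [norm_sub_rev]⟩
  · rw [← e] at h ⊢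
    exact ⟨h, by simpa using hδ⟩

/-- First order expansion of a resolvent entry, times a smooth function of the trace, in the
indicator of one edge. -/
theorem edge_difference_expansion (ht : 0 < t) (G : SimpleGraph V) {i j : V} (hij : i ≠ j)
    {h : SimpleGraph V → ℂ} {K L : ℝ} (hK : ∀ G, ‖h G‖ ≤ K)
    (hL : ‖h (G ⊔ edge i j) - h (G \ edge i j)‖ ≤ L * (√(Fintype.card V))⁻¹ ^ 2) :
    ‖(h (G ⊔ edge i j) * graphResolvent t (G ⊔ edge i j) j i -
        h (G \ edge i j) * graphResolvent t (G \ edge i j) j i) +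
      ((√(Fintype.card V))⁻¹ : ℝ) * h G * (graphResolvent t G j i ^ 2 +
        graphResolvent t G j j * graphResolvent t G i i)‖ ≤
      (8 * K / t ^ 3 + 2 * L / t) * (√(Fintype.card V))⁻¹ ^ 2 := by
  set c : ℝ := (√(Fintype.card V))⁻¹ with hc
  have hc0 : 0 ≤ c := by positivity
  have hK0 : 0 ≤ K := (norm_nonneg _).trans (hK G)
  have hr := graphResolvent_apply_norm_le (V := V) ht
  have hd : ∀ a b, _ := fun a b =>
    norm_edge_sub_self_le (f := fun G => graphResolvent t G a b)
      (graphResolvent_sub_apply_norm_le ht G hij a b)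
  obtain ⟨hh1, hh2⟩ := norm_edge_sub_self_le hL
  have hsub := graphResolvent_sub_apply ht G hij j i
  rw [← hc] at hsub
  simp only [← hc] at hd
  set R := graphResolvent t (G ⊔ edge i j)
  set S := graphResolvent t (G \ edge i j)
  set Q := graphResolvent t G
  -- The difference of resolvent entries already carries a factor `c`. Replacing `R` and `S` by `Q`
  -- in it costs a further `c`, and the variation of `h` is of order `c ^ 2`.
  have e : (h (G ⊔ edge i j) * R j i - h (G \ edge i j) * S j i) +
      c * h G * (Q j i ^ 2 + Q j j * Q i i) =
      -c * h G * ((R j i * S j i - Q j i * Q j i) + (R j j * S i i - Q j j * Q i i)) +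
      (h (G ⊔ edge i j) - h G) * R j i - (h (G \ edge i j) - h G) * S j i := by
    have : R j i = S j i + -c * (R j i * S j i + R j j * S i i) := by
      rw [← hsub]; ring
    linear_combination h G * this
  have hm : ∀ a b c' d, ‖R a b * S c' d - Q a b * Q c' d‖ ≤ 2 * (2 * c / t ^ 2 * (1 / t)) :=
    fun a b c' d => mul_sub_mul_add_norm_le (hr _ _ _) (hr _ _ _) (hd a b).1 (hd c' d).2
  rw [e]
  calc _ ≤ ‖-c * h G * ((R j i * S j i - Q j i * Q j i) + (R j j * S i i - Q j j * Q i i))‖ +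
        ‖(h (G ⊔ edge i j) - h G) * R j i‖ + ‖(h (G \ edge i j) - h G) * S j i‖ :=
        (norm_sub_le _ _).trans (add_le_add_left (norm_add_le _ _) _)
    _ ≤ c * K * (2 * (2 * c / t ^ 2 * (1 / t)) + 2 * (2 * c / t ^ 2 * (1 / t))) +
        L * c ^ 2 * (1 / t) + L * c ^ 2 * (1 / t) := by
        have hL0 : 0 ≤ L * c ^ 2 := (norm_nonneg _).trans hL
        simp only [norm_mul, norm_neg, Complex.norm_real, Real.norm_of_nonneg hc0]
        gcongr
        · exact hK G
        · exact (norm_add_le _ _).trans (add_le_add (hm _ _ _ _) (hm _ _ _ _))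
        · exact hr _ _ _
        · exact hr _ _ _
    _ = _ := by field_simp; ring

end SelfConsistent

/-! ### Mean square bound for the defect in the semicircle equation. -/

section SelfConsistent

open SimpleGraph Matrix Complex ComplexConjugate
open scoped Matrix.Norms.L2Operator

variable {V : Type*} [Fintype V] [DecidableEq V] {t : ℝ}

theorem sum_sum_eq_sum_offDiag_add {M : Type*} [AddCommMonoid M] (f : V → V → M) :
    ∑ i, ∑ j, f i j = ∑ e ∈ Finset.univ.offDiag, f e.1 e.2 + ∑ i, f i i := by
  rw [← Finset.sum_product', ← Finset.diag_union_offDiag,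
    Finset.sum_union (Finset.disjoint_diag_offDiag _), Finset.sum_diag, add_comm]

/-- The trace identity `sum_graphResolvent_eq` divided by n, with each off-diagonal adjacency entry
split into fluctuation and mean. The quadratic term is only carried along, so `v` is arbitrary. -/
theorem semicircleDefect_graphStieltjes_eq [Nonempty V] (ht : 0 < t) (p v : ℝ)
    (G : SimpleGraph V) :
    semicircleDefect v t (graphStieltjes t G) =
      ((√(Fintype.card V))⁻¹ : ℝ) / (Fintype.card V : ℂ) * (∑ e ∈ Finset.univ.offDiag,
        ((realAdjMatrix G e.1 e.2 - p : ℝ) : ℂ) * graphResolvent t G e.2 e.1) +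
      ((√(Fintype.card V))⁻¹ : ℝ) / (Fintype.card V : ℂ) * (p * ∑ e ∈ Finset.univ.offDiag,
        graphResolvent t G e.2 e.1) + v * graphStieltjes t G ^ 2 := by
  have hn : (Fintype.card V : ℂ) ≠ 0 := by exact_mod_cast Fintype.card_ne_zero
  have h := sum_graphResolvent_eq ht G
  rw [sum_sum_eq_sum_offDiag_add] at h
  have h0 : ∑ i, (realAdjMatrix G i i : ℂ) * graphResolvent t G i i = 0 :=
    Finset.sum_eq_zero fun i _ => by
      rw [realAdjMatrix_of_not_adj G.irrefl]; simp
  rw [h0, add_zero] at h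
  have hs : graphStieltjes t G * Fintype.card V = (graphResolvent t G).trace :=
    div_mul_cancel₀ _ hn
  simp only [ofReal_sub, sub_mul, Finset.sum_sub_distrib, ← Finset.mul_sum, mul_sub]
  rw [semicircleDefect, sub_add_cancel, div_mul_eq_mul_div, h, ← hs]
  field_simp

/-- After integration by parts, what remains of the defect is of the order of the inverse of the
square root of the size. -/
theorem remainder_norm_le [Nonempty V] (ht : 0 < t) {p v : ℝ} (hp0 : 0 ≤ p) (hp1 : p ≤ 1)
    (hv0 : 0 ≤ v) (hv1 : v ≤ 1) (G : SimpleGraph V) :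
    ‖((√(Fintype.card V))⁻¹ : ℝ) / (Fintype.card V : ℂ) * (p * ∑ e ∈ Finset.univ.offDiag,
        graphResolvent t G e.2 e.1) + v * graphStieltjes t G ^ 2 -
      v / (Fintype.card V : ℂ) ^ 2 * ∑ e ∈ Finset.univ.offDiag, (graphResolvent t G e.2 e.1 ^ 2 +
        graphResolvent t G e.2 e.2 * graphResolvent t G e.1 e.1)‖ ≤
      (2 / t + 2 / t ^ 2) * (√(Fintype.card V))⁻¹ := by
  set n : ℝ := ((Fintype.card V : ℕ) : ℝ) with hnd
  have hn1 : 1 ≤ n := by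
    rw [hnd]; exact_mod_cast Nat.one_le_iff_ne_zero.2 Fintype.card_ne_zero
  have hn : (n : ℂ) ≠ 0 := by
    rw [Complex.ofReal_ne_zero]; positivity
  have hnc : (Fintype.card V : ℂ) = (n : ℂ) := by simp [hnd]
  set c : ℝ := (√n)⁻¹ with hc
  have hc0 : 0 ≤ c := by positivity
  have hcn : n⁻¹ ≤ c := by
    rw [hc]
    gcongr
    exact Real.sqrt_le_self_iff.2 (Or.inr hn1)
  set R := graphResolvent t G with hR
  have hRn : ‖R‖ ≤ 1 / t := graphResolvent_norm_le ht G
  have hr : ∀ i j, ‖R i j‖ ≤ 1 / t := graphResolvent_apply_norm_le ht G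
  have hs : graphStieltjes t G ^ 2 = (n : ℂ)⁻¹ ^ 2 * ∑ i, ∑ j, R j j * R i i := by
    rw [graphStieltjes, ← hR, hnc, div_eq_mul_inv, mul_pow, mul_comm, sq R.trace]
    congr 1
    rw [trace, Finset.sum_mul_sum, Finset.sum_comm]
    rfl
  rw [sum_sum_eq_sum_offDiag_add] at hs
  have hA : ‖∑ e ∈ Finset.univ.offDiag, R e.2 e.1‖ ≤ 2 * n / t := by
    have h1 : ∑ e ∈ Finset.univ.offDiag, R e.2 e.1 = (∑ i, ∑ j, R i j) - ∑ i, R i i := by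
      have h2 := sum_sum_eq_sum_offDiag_add (fun i j => R j i)
      rw [Finset.sum_comm] at h2
      rw [h2, add_sub_cancel_right]
    rw [h1]
    calc _ ≤ ‖∑ i, ∑ j, R i j‖ + ‖∑ i, R i i‖ := norm_sub_le _ _
      _ ≤ 1 / t * n + ∑ i : V, 1 / t := by
          gcongr
          · exact (norm_sum_entries_le R).trans (by gcongr)
          · exact norm_sum_le_of_le _ fun i _ => hr i i
      _ = _ := by simp [← hnd]; ring
  have hB : ‖∑ e ∈ Finset.univ.offDiag, R e.2 e.1 ^ 2‖ ≤ n / t ^ 2 := by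
    calc _ ≤ ∑ e ∈ Finset.univ.offDiag, ‖R e.2 e.1‖ ^ 2 :=
          norm_sum_le_of_le _ fun e _ => by rw [norm_pow]
      _ ≤ ∑ i, ∑ j, ‖R j i‖ ^ 2 := by
          rw [sum_sum_eq_sum_offDiag_add]
          exact le_add_of_nonneg_right (by positivity)
      _ = ∑ j, ∑ i, ‖R j i‖ ^ 2 := Finset.sum_comm
      _ ≤ ∑ j : V, (1 / t) ^ 2 := by
          gcongr with j
          exact (sum_norm_sq_row_le R j).trans (by gcongr)
      _ = _ := by simp [← hnd]; ring
  have hC : ‖∑ i, R i i * R i i‖ ≤ n / t ^ 2 := by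
    calc _ ≤ ∑ i : V, (1 / t) * (1 / t) := norm_sum_le_of_le _ fun i _ => by
            rw [norm_mul]; gcongr <;> exact hr i i
      _ = _ := by simp [← hnd]; ring
  -- The off-diagonal products `R j j * R i i` cancel against the square of the trace. The sums that
  -- remain have order n by `hA`, `hB` and `hC`.
  have e : (c : ℂ) / (n : ℂ) * (p * ∑ e ∈ Finset.univ.offDiag, R e.2 e.1) +
      v * graphStieltjes t G ^ 2 - v / (n : ℂ) ^ 2 * ∑ e ∈ Finset.univ.offDiag, (R e.2 e.1 ^ 2 +
        R e.2 e.2 * R e.1 e.1) =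
      (c / n * p : ℝ) * (∑ e ∈ Finset.univ.offDiag, R e.2 e.1) +
      (v / n ^ 2 : ℝ) * ∑ i, R i i * R i i -
      (v / n ^ 2 : ℝ) * ∑ e ∈ Finset.univ.offDiag, R e.2 e.1 ^ 2 := by
    rw [hs, Finset.sum_add_distrib]
    push_cast
    field_simp
    ring
  rw [hnc, e]
  calc _ ≤ ‖(c / n * p : ℝ) * (∑ e ∈ Finset.univ.offDiag, R e.2 e.1)‖ +
      ‖(v / n ^ 2 : ℝ) * ∑ i, R i i * R i i‖ +
      ‖(v / n ^ 2 : ℝ) * ∑ e ∈ Finset.univ.offDiag, R e.2 e.1 ^ 2‖ :=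
        (norm_sub_le _ _).trans (add_le_add_left (norm_add_le _ _) _)
    _ ≤ c / n * 1 * (2 * n / t) + 1 / n ^ 2 * (n / t ^ 2) + 1 / n ^ 2 * (n / t ^ 2) := by
        rw [norm_mul, norm_mul, norm_mul, Complex.norm_real, Complex.norm_real,
          Real.norm_of_nonneg (by positivity), Real.norm_of_nonneg (by positivity)]
        gcongr
    _ = 2 / t * c + 2 / t ^ 2 * n⁻¹ := by field_simp; ring
    _ ≤ 2 / t * c + 2 / t ^ 2 * c := by gcongr
    _ = _ := by ring

/-- The second moment of the defect in the semicircle equation. -/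
theorem exists_sum_binomialWeight_defect_le (p : unitInterval) (ht : 0 < t) :
    ∃ C : ℝ, ∀ (V : Type) [Fintype V] [DecidableEq V] [Nonempty V],
      ∑ G : SimpleGraph V, binomialWeight p G *
        ‖semicircleDefect (p * (1 - p)) t (graphStieltjes t G)‖ ^ 2 ≤
      C * (√(Fintype.card V))⁻¹ := by
  have hp0 : (0 : ℝ) ≤ p := p.2.1
  have hp1 : (p : ℝ) ≤ 1 := p.2.2
  set v : ℝ := p * (1 - p) with hv
  have hv0 : 0 ≤ v := mul_nonneg hp0 (by linarith)
  have hv1 : v ≤ 1 := by nlinarith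
  set K := 2 + 1 / t ^ 2 with hKd
  set L := 2 / t ^ 2 * (t + 2 / t) with hLd
  refine ⟨K * (2 / t + 2 / t ^ 2) + (8 * K / t ^ 3 + 2 * L / t), ?_⟩
  intro V _ _ _
  set n : ℝ := ((Fintype.card V : ℕ) : ℝ) with hnd
  have hn1 : 1 ≤ n := by
    rw [hnd]; exact_mod_cast Nat.one_le_iff_ne_zero.2 Fintype.card_ne_zero
  have hn : (n : ℂ) ≠ 0 := by
    rw [Complex.ofReal_ne_zero]; positivity
  have hnc : (Fintype.card V : ℂ) = (n : ℂ) := by simp [hnd]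
  set c : ℝ := (√n)⁻¹ with hc
  have hc0 : 0 ≤ c := by positivity
  have hc2 : c ^ 2 = n⁻¹ := by
    rw [hc, inv_pow, Real.sq_sqrt (by positivity)]
  have hc1 : c ≤ 1 := inv_le_one_of_one_le₀ (Real.one_le_sqrt.2 hn1)
  set P : SimpleGraph V → ℂ := fun G => semicircleDefect v t (graphStieltjes t G) with hP
  -- Writing `‖P G‖ ^ 2` as `h G * P G` and expanding only the factor `P G` exposes the centred
  -- adjacency entries; `h` joins the test function.
  set h : SimpleGraph V → ℂ := fun G => conj (P G) with hh
  have hK : ∀ G, ‖h G‖ ≤ K := fun G => by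
    rw [hh, RCLike.norm_conj]
    exact semicircleDefect_norm_le ht hv0 hv1 (graphStieltjes_norm_le ht G)
  have hL : ∀ G i j, i ≠ j → ‖h (G ⊔ edge i j) - h (G \ edge i j)‖ ≤ L * c ^ 2 := by
    intro G i j hij
    rw [hh, ← map_sub, RCLike.norm_conj]
    calc _ ≤ _ := semicircleDefect_sub_norm_le ht hv0 hv1 (graphStieltjes_norm_le ht _)
          (graphStieltjes_norm_le ht _)
      _ ≤ 2 * c / (n * t ^ 2) * (t + 2 / t) := by
          gcongr
          exact graphStieltjes_sub_norm_le ht G hij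
      _ ≤ 2 * 1 / (n * t ^ 2) * (t + 2 / t) := by gcongr
      _ = L * c ^ 2 := by rw [hc2, hLd]; field_simp
  set D : Finset (V × V) := Finset.univ.offDiag with hD
  set Rem : SimpleGraph V → ℂ := fun G =>
    (c : ℂ) / (n : ℂ) * (p * ∑ e ∈ D, graphResolvent t G e.2 e.1) +
      v * graphStieltjes t G ^ 2 -
      v / (n : ℂ) ^ 2 * ∑ e ∈ D, (graphResolvent t G e.2 e.1 ^ 2 +
        graphResolvent t G e.2 e.2 * graphResolvent t G e.1 e.1) with hRem
  have hRemle : ∀ G, ‖Rem G‖ ≤ (2 / t + 2 / t ^ 2) * c := fun G => by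
    simp only [hRem, hc, ← hnc]
    exact remainder_norm_le ht hp0 hp1 hv0 hv1 G
  set err : SimpleGraph V → V × V → ℂ := fun G e =>
    (h (G ⊔ edge e.1 e.2) * graphResolvent t (G ⊔ edge e.1 e.2) e.2 e.1 -
        h (G \ edge e.1 e.2) * graphResolvent t (G \ edge e.1 e.2) e.2 e.1) +
      c * h G * (graphResolvent t G e.2 e.1 ^ 2 +
        graphResolvent t G e.2 e.2 * graphResolvent t G e.1 e.1) with herr
  have hne : ∀ e ∈ D, e.1 ≠ e.2 := fun e he => (Finset.mem_offDiag.1 he).2.2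
  have herrle : ∀ G, ∀ e ∈ D, ‖err G e‖ ≤ (8 * K / t ^ 3 + 2 * L / t) * c ^ 2 :=
    fun G e he => edge_difference_expansion ht G (hne e he) hK (hL G _ _ (hne e he))
  have hibp : ∀ e ∈ D, ∑ G, (binomialWeight p G : ℂ) * (h G *
      (((realAdjMatrix G e.1 e.2 - p : ℝ) : ℂ) * graphResolvent t G e.2 e.1)) =
      v * ∑ G, (binomialWeight p G : ℂ) * (err G e - c * h G * (graphResolvent t G e.2 e.1 ^ 2 +
        graphResolvent t G e.2 e.2 * graphResolvent t G e.1 e.1)) := by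
    intro e he
    have := sum_binomialWeight_centered_smul p (hne e he)
      (fun G => h G * graphResolvent t G e.2 e.1)
    simp only [Complex.real_smul] at this
    rw [hv]
    refine Eq.trans (Finset.sum_congr rfl fun G _ => by ring) (this.trans ?_)
    congr 1
    refine Finset.sum_congr rfl fun G _ => ?_
    simp only [herr]
    ring
  -- The leading terms of the integration by parts have coefficient `c / n * c = 1 / n ^ 2` times
  -- `v`, and cancel the sum that `Rem` subtracts. Only `Rem` and `err` survive.
  have main : ((∑ G, binomialWeight p G * ‖P G‖ ^ 2 : ℝ) : ℂ) =
      ∑ G, (binomialWeight p G : ℂ) * (h G * Rem G + (c / n * v : ℝ) * ∑ e ∈ D, err G e) := by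
    have h1 : ∀ G, ((binomialWeight p G * ‖P G‖ ^ 2 : ℝ) : ℂ) =
        (c / n : ℂ) * (∑ e ∈ D, (binomialWeight p G : ℂ) * (h G *
          (((realAdjMatrix G e.1 e.2 - p : ℝ) : ℂ) * graphResolvent t G e.2 e.1))) +
        (binomialWeight p G : ℂ) * (h G * (Rem G + v / (n : ℂ) ^ 2 * ∑ e ∈ D,
          (graphResolvent t G e.2 e.1 ^ 2 +
            graphResolvent t G e.2 e.2 * graphResolvent t G e.1 e.1))) := by
      intro G
      have h2 : ((‖P G‖ ^ 2 : ℝ) : ℂ) = h G * P G := by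
        rw [hh]; push_cast; exact (Complex.conj_mul' (P G)).symm
      have h3 := semicircleDefect_graphStieltjes_eq ht p v G
      rw [hnc, ← hnd, ← hc] at h3
      rw [Complex.ofReal_mul, h2, ← Finset.mul_sum, ← Finset.mul_sum]
      simp only [hP, hRem]
      rw [h3]
      ring
    rw [Complex.ofReal_sum, Finset.sum_congr rfl fun G _ => h1 G, Finset.sum_add_distrib,
      ← Finset.mul_sum, Finset.sum_comm, Finset.sum_congr rfl hibp, ← Finset.mul_sum,
      Finset.sum_comm, Finset.mul_sum, Finset.mul_sum, ← Finset.sum_add_distrib]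
    refine Finset.sum_congr rfl fun G _ => ?_
    rw [← Finset.mul_sum, Finset.sum_sub_distrib, ← Finset.mul_sum]
    have hcc : (c : ℂ) ^ 2 = (n : ℂ)⁻¹ := by rw [← Complex.ofReal_pow, hc2, Complex.ofReal_inv]
    push_cast
    have hcc' : (c : ℂ) / n * c = 1 / n ^ 2 := by
      rw [div_mul_eq_mul_div, ← sq, hcc]; field_simp
    linear_combination (-(v * (binomialWeight p G : ℂ) * h G * ∑ e ∈ D,
      (graphResolvent t G e.2 e.1 ^ 2 +
        graphResolvent t G e.2 e.2 * graphResolvent t G e.1 e.1))) * hcc'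
  have hcardD : (D.card : ℝ) ≤ n ^ 2 := by
    have : D.card ≤ Fintype.card V * Fintype.card V := by
      rw [hD, Finset.offDiag_card, Finset.card_univ]; exact Nat.sub_le _ _
    rw [hnd, sq]
    exact_mod_cast this
  have hterm : ∀ G, ‖h G * Rem G + (c / n * v : ℝ) * ∑ e ∈ D, err G e‖ ≤
      (K * (2 / t + 2 / t ^ 2) + (8 * K / t ^ 3 + 2 * L / t)) * c := by
    intro G
    have hs : ‖∑ e ∈ D, err G e‖ ≤ n ^ 2 * ((8 * K / t ^ 3 + 2 * L / t) * c ^ 2) := by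
      calc _ ≤ ∑ e ∈ D, (8 * K / t ^ 3 + 2 * L / t) * c ^ 2 := norm_sum_le_of_le _ (herrle G)
        _ = D.card * ((8 * K / t ^ 3 + 2 * L / t) * c ^ 2) := by simp
        _ ≤ _ := by gcongr
    calc _ ≤ ‖h G * Rem G‖ + ‖(c / n * v : ℝ) * ∑ e ∈ D, err G e‖ := norm_add_le _ _
      _ ≤ K * ((2 / t + 2 / t ^ 2) * c) +
          c / n * 1 * (n ^ 2 * ((8 * K / t ^ 3 + 2 * L / t) * c ^ 2)) := by
          rw [norm_mul, norm_mul, Complex.norm_real, Real.norm_of_nonneg (by positivity)]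
          gcongr
          · exact hK G
          · exact hRemle G
      _ = _ := by rw [hc2]; field_simp
  calc ∑ G, binomialWeight p G * ‖P G‖ ^ 2 ≤ ‖((∑ G, binomialWeight p G * ‖P G‖ ^ 2 : ℝ) : ℂ)‖ := by
        rw [Complex.norm_real]; exact le_abs_self _
    _ ≤ ∑ G : SimpleGraph V, binomialWeight p G *
        ((K * (2 / t + 2 / t ^ 2) + (8 * K / t ^ 3 + 2 * L / t)) * c) := by
        rw [main]
        refine norm_sum_le_of_le _ fun G _ => ?_
        rw [norm_mul, Complex.norm_real, Real.norm_of_nonneg (binomialWeight_nonneg p G)]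
        exact mul_le_mul_of_nonneg_left (hterm G) (binomialWeight_nonneg p G)
    _ = _ := by rw [← Finset.sum_mul, sum_binomialWeight, one_mul]

end SelfConsistent

/-! ### Coulson's integral, the semicircle integral and stability of the quadratic equation. -/

section CoulsonIntegral

open MeasureTheory Filter Topology Set

theorem coulson_integral (x : ℝ) :
    IntegrableOn (fun t : ℝ => x ^ 2 / (x ^ 2 + t ^ 2)) (Ioi 0) ∧
      ∫ t in Ioi (0 : ℝ), x ^ 2 / (x ^ 2 + t ^ 2) = Real.pi / 2 * |x| := by
  rcases eq_or_ne x 0 with rfl | hx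
  · simp
  set a := |x| with ha
  have ha0 : 0 < a := abs_pos.2 hx
  have hxa : x ^ 2 = a ^ 2 := (sq_abs x).symm
  rw [hxa]
  have hd : ∀ t ∈ Ici (0 : ℝ),
      HasDerivAt (fun t => a * Real.arctan (t / a)) (a ^ 2 / (a ^ 2 + t ^ 2)) t := by
    intro t _
    have h := (((hasDerivAt_id t).div_const a).arctan).const_mul a
    refine h.congr_deriv ?_
    simp only [id]
    field_simp
  have hpos : ∀ t ∈ Ioi (0 : ℝ), 0 ≤ a ^ 2 / (a ^ 2 + t ^ 2) := fun t _ => by positivity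
  have hlim : Tendsto (fun t => a * Real.arctan (t / a)) atTop (𝓝 (a * (Real.pi / 2))) :=
    ((Real.tendsto_arctan_atTop.mono_right nhdsWithin_le_nhds).comp
      (tendsto_id.atTop_div_const ha0)).const_mul a
  refine ⟨integrableOn_Ioi_deriv_of_nonneg' hd hpos hlim, ?_⟩
  rw [integral_Ioi_of_hasDerivAt_of_nonneg' hd hpos hlim]
  simp [mul_comm]

/-- The Stieltjes transform at `t * I` of the semicircle law of variance `v`, divided by `I`. -/
noncomputable def semicircleStieltjes (v t : ℝ) : ℝ := (√(t ^ 2 + 4 * v) - t) / (2 * v)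

variable {v : ℝ} {t : ℝ}

theorem semicircleStieltjes_eq (hv : 0 < v) (t : ℝ) :
    1 - t * semicircleStieltjes v t = v * semicircleStieltjes v t ^ 2 := by
  have h := Real.sq_sqrt (show 0 ≤ t ^ 2 + 4 * v by positivity)
  rw [semicircleStieltjes]
  field_simp
  linear_combination -h

theorem semicircleStieltjes_pos (hv : 0 < v) (t : ℝ) : 0 < semicircleStieltjes v t := by
  rw [semicircleStieltjes]
  have : t < √(t ^ 2 + 4 * v) := Real.lt_sqrt_of_sq_lt (by linarith)
  exact div_pos (by linarith) (by linarith)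

/-- The same three bounds hold for the random integrand in `coulsonIntegrand_mem`; together they
yield an integrable dominating function. -/
theorem one_sub_mul_semicircleStieltjes_mem (hv : 0 < v) (hv1 : v ≤ 1) (ht : 0 < t) :
    0 ≤ 1 - t * semicircleStieltjes v t ∧ 1 - t * semicircleStieltjes v t ≤ 1 ∧
      (1 - t * semicircleStieltjes v t) * t ^ 2 ≤ 1 := by
  have h := semicircleStieltjes_eq hv t
  have hm := semicircleStieltjes_pos hv t
  set m := semicircleStieltjes v t
  have h0 : 0 ≤ v * m ^ 2 := by positivity
  have h1 : t * m ≤ 1 := by linarith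
  have h2 : (t * m) ^ 2 ≤ 1 := pow_le_one₀ ((mul_pos ht hm).le) h1
  refine ⟨by linarith, by nlinarith [mul_pos ht hm], ?_⟩
  rw [h]
  nlinarith

theorem semicircle_integral (hv : 0 < v) :
    IntegrableOn (fun t : ℝ => 1 - t * semicircleStieltjes v t) (Ioi 0) ∧
      ∫ t in Ioi (0 : ℝ), (1 - t * semicircleStieltjes v t) = 4 / 3 * √v := by
  set r : ℝ → ℝ := fun t => √(t ^ 2 + 4 * v) with hr
  have hr2 : ∀ t, r t ^ 2 = t ^ 2 + 4 * v := fun t => Real.sq_sqrt (by positivity)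
  have hrpos : ∀ t, 0 < r t := fun t => Real.sqrt_pos.2 (by positivity)
  -- An explicit antiderivative that vanishes at infinity; `F 0 = -(4 / 3) * √v` gives the value of
  -- the integral.
  set F : ℝ → ℝ := fun t => t + (t ^ 3 - r t ^ 3) / (6 * v) with hF
  have hd : ∀ t ∈ Ici (0 : ℝ), HasDerivAt F (1 - t * semicircleStieltjes v t) t := by
    intro t _
    have h1 : HasDerivAt (fun t : ℝ => t ^ 2 + 4 * v) (2 * t) t := by
      simpa using (hasDerivAt_pow 2 t).add_const (4 * v)
    have h2 : HasDerivAt r (2 * t / (2 * r t)) t := h1.sqrt (by positivity)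
    have h3 := (hasDerivAt_id t).add (((hasDerivAt_pow 3 t).sub (h2.pow 3)).div_const (6 * v))
    refine HasDerivAt.congr_deriv (f := F) h3 ?_
    have := (hrpos t).ne'
    rw [semicircleStieltjes, show √(t ^ 2 + 4 * v) = r t from rfl]
    push_cast
    field_simp
    ring
  have hpos : ∀ t ∈ Ioi (0 : ℝ), 0 ≤ 1 - t * semicircleStieltjes v t := fun t _ => by
    rw [semicircleStieltjes_eq hv]; positivity
  have hlim : Tendsto F atTop (𝓝 0) := by
    have hz : Tendsto (fun t : ℝ => (16 * v / 6) / t) atTop (𝓝 0) :=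
      tendsto_const_nhds.div_atTop tendsto_id
    refine squeeze_zero_norm' ?_ hz
    filter_upwards [eventually_gt_atTop 0] with t ht
    have hx := hrpos t
    have h2 := hr2 t
    have e : F t = -(8 * v / 6 * ((t + 2 * r t) / (r t + t) ^ 2)) := by
      simp only [hF]
      field_simp
      have e5 : v = (r t ^ 2 - t ^ 2) / 4 := by linarith
      rw [e5]
      ring
    rw [e, norm_neg, Real.norm_of_nonneg (by positivity)]
    have : (t + 2 * r t) / (r t + t) ^ 2 ≤ 2 / t := by
      rw [div_le_div_iff₀ (by positivity) ht]
      nlinarith [mul_pos hx ht]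
    calc _ ≤ 8 * v / 6 * (2 / t) := by gcongr
      _ = _ := by ring
  refine ⟨integrableOn_Ioi_deriv_of_nonneg' hd hpos hlim, ?_⟩
  rw [integral_Ioi_of_hasDerivAt_of_nonneg' hd hpos hlim]
  have h0 : r 0 = 2 * √v := by
    simp only [hr]
    rw [show (0 : ℝ) ^ 2 + 4 * v = 2 ^ 2 * v by ring, Real.sqrt_mul (by positivity),
      Real.sqrt_sq (by norm_num)]
  have hs := Real.sq_sqrt hv.le
  simp only [hF, h0]
  field_simp
  linear_combination (24 * √v) * hs

open Complex in
/-- Stability of the quadratic equation of the semicircle law in the upper half plane. -/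
theorem abs_im_sub_semicircleStieltjes_le (hv : 0 < v) (ht : 0 < t) {s : ℂ} (hs : 0 ≤ s.im) :
    |t * s.im - t * semicircleStieltjes v t| ≤ ‖semicircleDefect v t s‖ := by
  set r := √(t ^ 2 + 4 * v) with hr
  have hr2 : r ^ 2 = t ^ 2 + 4 * v := Real.sq_sqrt (by positivity)
  have hrt : t ≤ r := Real.le_sqrt_of_sq_le (by linarith)
  set m := semicircleStieltjes v t with hm
  have hm' : m = (r - t) / (2 * v) := rfl
  set m' : ℝ := (r + t) / (2 * v) with hmm
  have hvC : (v : ℂ) ≠ 0 := by exact_mod_cast hv.ne'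
  have hr2C : (r : ℂ) ^ 2 = t ^ 2 + 4 * v := by exact_mod_cast hr2
  -- The two roots are `m * I` and `-m' * I`. For `s` in the closed upper half plane the second
  -- factor is at least `v * m' = (r + t) / 2 ≥ t` in norm.
  have e : semicircleDefect v t s = (s - m * I) * (v * (s + m' * I)) := by
    rw [semicircleDefect, hm', hmm]
    push_cast
    field_simp
    linear_combination (-1 : ℂ) * hr2C + ((r : ℂ) ^ 2 - t ^ 2) * I_sq
  have h1 : |s.im - m| ≤ ‖s - m * I‖ := by
    simpa using abs_im_le_norm (s - m * I)
  have h2 : t ≤ ‖v * (s + m' * I)‖ := by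
    have h3 : |s.im + m'| ≤ ‖s + m' * I‖ := by
      simpa using abs_im_le_norm (s + m' * I)
    have h4 : v * m' = (r + t) / 2 := by rw [hmm]; field_simp
    rw [norm_mul, Complex.norm_real, Real.norm_of_nonneg hv.le]
    have h5 := le_abs_self (s.im + m')
    nlinarith
  rw [e, norm_mul, ← mul_sub, abs_mul, abs_of_pos ht, mul_comm]
  exact mul_le_mul h1 h2 ht.le (norm_nonneg _)

/-- Both sides are the trace of `A * A`. -/
theorem sum_sq_eigenvalues {V : Type*} [Fintype V] [DecidableEq V] {A : Matrix V V ℝ}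
    (hA : A.IsHermitian) : ∑ i, hA.eigenvalues i ^ 2 = ∑ i, ∑ j, A i j ^ 2 := by
  have h := hA.spectral_theorem
  rw [Unitary.conjStarAlgAut_apply] at h
  have h2 := Unitary.star_mul_self_of_mem hA.eigenvectorUnitary.2
  set U : Matrix V V ℝ := (hA.eigenvectorUnitary : Matrix V V ℝ)
  set d : Matrix V V ℝ := Matrix.diagonal (RCLike.ofReal ∘ hA.eigenvalues) with hd
  have e : (A * A).trace = (d * d).trace := by
    calc (A * A).trace = (U * d * star U * (U * d * star U)).trace := by rw [← h]
      _ = (U * (d * (star U * U) * d * star U)).trace := by simp only [mul_assoc]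
      _ = (d * d * (star U * U)).trace := by
          rw [h2, mul_one, Matrix.trace_mul_comm, mul_assoc, h2]
      _ = _ := by rw [h2, mul_one]
  rw [hd, Matrix.diagonal_mul_diagonal, Matrix.trace_diagonal] at e
  simp only [Function.comp, RCLike.ofReal_real_eq_id, id] at e
  calc _ = ∑ i, hA.eigenvalues i * hA.eigenvalues i := by simp only [sq]
    _ = _ := e.symm
    _ = _ := by
      rw [Matrix.trace]
      refine Finset.sum_congr rfl fun i _ => ?_
      rw [Matrix.diag_apply, Matrix.mul_apply]
      refine Finset.sum_congr rfl fun j _ => ?_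
      have : A j i = A i j := by simpa using hA.apply i j
      rw [this, sq]

end CoulsonIntegral

/-! ### Convergence of the normalized energy in mean and in probability. -/

section Convergence

open SimpleGraph MeasureTheory Filter Topology Set

variable {V : Type*} [Fintype V] [DecidableEq V]

/-- The energy of the adjacency matrix. -/
noncomputable def graphEnergy (G : SimpleGraph V) : ℝ := matrixEnergy (realAdjMatrix_isHermitian G)

theorem HasDiameterTwo.reverseWienerEnergy_eq {G : SimpleGraph V} (h : HasDiameterTwo G) :
    reverseWienerEnergy G = graphEnergy G := by
  have key : ∀ {A B : Matrix V V ℝ} (hA : A.IsHermitian) (hB : B.IsHermitian), A = B →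
      matrixEnergy hA = matrixEnergy hB := by
    rintro A B hA hB rfl; rfl
  exact key _ _ h.reverseWienerMatrix_eq

/-- An eigenvalue of the adjacency matrix divided by the square root of the number of vertices. -/
noncomputable def scaledEigenvalue (G : SimpleGraph V) (i : V) : ℝ :=
  (√(Fintype.card V))⁻¹ * (realAdjMatrix_isHermitian G).eigenvalues i

/-- The integrand of the Coulson formula for the energy of the scaled adjacency matrix. -/
noncomputable def coulsonIntegrand (G : SimpleGraph V) (t : ℝ) : ℝ :=
  (∑ i, scaledEigenvalue G i ^ 2 / (scaledEigenvalue G i ^ 2 + t ^ 2)) / Fintype.card V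

theorem coulsonIntegrand_integral (G : SimpleGraph V) :
    IntegrableOn (coulsonIntegrand G) (Ioi 0) ∧ ∫ t in Ioi (0 : ℝ), coulsonIntegrand G t =
      Real.pi / 2 * (graphEnergy G / (Fintype.card V * √(Fintype.card V))) := by
  have hint := fun i : V => coulson_integral (scaledEigenvalue G i)
  refine ⟨(integrable_finsetSum _ fun i _ => (hint i).1).div_const _, ?_⟩
  simp only [coulsonIntegrand]
  rw [integral_div, integral_finsetSum _ fun i _ => (hint i).1,
    Finset.sum_congr rfl fun i _ => (hint i).2, ← Finset.mul_sum, graphEnergy, matrixEnergy]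
  simp only [scaledEigenvalue, abs_mul, abs_inv, abs_of_nonneg (Real.sqrt_nonneg _)]
  rw [← Finset.mul_sum]
  ring

theorem coulsonIntegrand_eq [Nonempty V] (G : SimpleGraph V) {t : ℝ} (ht : 0 < t) :
    coulsonIntegrand G t = 1 - t * (graphStieltjes t G).im := by
  have hn : (Fintype.card V : ℝ) ≠ 0 := by exact_mod_cast Fintype.card_ne_zero
  have h1 : (graphStieltjes t G).im =
      (∑ i, t / (scaledEigenvalue G i ^ 2 + t ^ 2)) / Fintype.card V := by
    rw [graphStieltjes, Complex.div_natCast_im, graphResolvent,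
      trace_imagResolvent_im (realAdjMatrix_isHermitian G) _ ht]
    rfl
  have h2 : ∀ i, scaledEigenvalue G i ^ 2 / (scaledEigenvalue G i ^ 2 + t ^ 2) =
      1 - t * (t / (scaledEigenvalue G i ^ 2 + t ^ 2)) := fun i => by
    have : scaledEigenvalue G i ^ 2 + t ^ 2 ≠ 0 := by positivity
    field_simp
    ring
  rw [h1, coulsonIntegrand, Finset.sum_congr rfl fun i _ => h2 i, Finset.sum_sub_distrib,
    ← Finset.mul_sum]
  simp
  field_simp

theorem sum_sq_scaledEigenvalue_le (G : SimpleGraph V) :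
    ∑ i, scaledEigenvalue G i ^ 2 ≤ Fintype.card V := by
  simp only [scaledEigenvalue, mul_pow]
  rw [← Finset.mul_sum, sum_sq_eigenvalues, inv_pow, Real.sq_sqrt (by positivity)]
  have h : ∑ i, ∑ j, realAdjMatrix G i j ^ 2 ≤ ∑ i : V, ∑ j : V, (1 : ℝ) := by
    gcongr with i _ j _
    exact pow_le_one₀ (realAdjMatrix_nonneg G i j) (realAdjMatrix_le_one G i j)
  simp only [Finset.sum_const, Finset.card_univ, nsmul_eq_mul, mul_one] at h
  calc _ ≤ (Fintype.card V : ℝ)⁻¹ * (Fintype.card V * Fintype.card V) := by gcongr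
    _ ≤ _ := by
      rcases eq_or_ne (Fintype.card V : ℝ) 0 with h0 | h0
      · simp [h0]
      · rw [inv_mul_cancel_left₀ h0]

/-- The decay in `t` comes from the second moment: the squares of the scaled eigenvalues sum to at
most n. -/
theorem coulsonIntegrand_mem (G : SimpleGraph V) {t : ℝ} (ht : 0 < t) :
    0 ≤ coulsonIntegrand G t ∧ coulsonIntegrand G t ≤ 1 ∧ coulsonIntegrand G t * t ^ 2 ≤ 1 := by
  have hn : (0 : ℝ) ≤ Fintype.card V := by positivity
  refine ⟨div_nonneg (Finset.sum_nonneg fun i _ => by positivity) hn, ?_, ?_⟩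
  · refine div_le_one_of_le₀ ?_ hn
    calc _ ≤ ∑ _i : V, (1 : ℝ) := by
          gcongr with i
          exact div_le_one_of_le₀ (by nlinarith) (by positivity)
      _ = _ := by simp
  · rw [coulsonIntegrand, div_mul_eq_mul_div]
    refine div_le_one_of_le₀ ?_ hn
    refine le_trans ?_ (sum_sq_scaledEigenvalue_le G)
    rw [Finset.sum_mul]
    gcongr with i
    rw [div_mul_eq_mul_div]
    refine div_le_of_le_mul₀ (by positivity) (by positivity) ?_
    nlinarith [sq_nonneg (scaledEigenvalue G i)]

theorem abs_sub_le_two_mul_inv_one_add_sq {x y t : ℝ} (hx : 0 ≤ x ∧ x ≤ 1 ∧ x * t ^ 2 ≤ 1)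
    (hy : 0 ≤ y ∧ y ≤ 1 ∧ y * t ^ 2 ≤ 1) : |x - y| ≤ 2 * (1 + t ^ 2)⁻¹ := by
  rw [← div_eq_mul_inv, le_div_iff₀ (by positivity)]
  rcases abs_cases (x - y) with ⟨h, _⟩ | ⟨h, _⟩ <;> rw [h] <;> nlinarith [sq_nonneg t]

variable (p : unitInterval)

/-- The mean distance of the Coulson integrand from its semicircle limit. -/
noncomputable def meanCoulsonGap (V : Type*) [Fintype V] [DecidableEq V] (p : unitInterval)
    (t : ℝ) : ℝ :=
  ∑ G : SimpleGraph V, binomialWeight p G *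
    |coulsonIntegrand G t - (1 - t * semicircleStieltjes (p * (1 - p)) t)|

theorem meanCoulsonGap_nonneg (t : ℝ) : 0 ≤ meanCoulsonGap V p t :=
  Finset.sum_nonneg fun G _ => mul_nonneg (binomialWeight_nonneg p G) (abs_nonneg _)

theorem mul_one_sub_le_one : (p * (1 - p) : ℝ) ≤ 1 := by
  nlinarith [p.2.1, p.2.2]

theorem meanCoulsonGap_le (hv : 0 < (p * (1 - p) : ℝ)) {t : ℝ} (ht : 0 < t) :
    meanCoulsonGap V p t ≤ 2 * (1 + t ^ 2)⁻¹ := by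
  calc _ ≤ ∑ G : SimpleGraph V, binomialWeight p G * (2 * (1 + t ^ 2)⁻¹) := by
        refine Finset.sum_le_sum fun G _ => ?_
        refine mul_le_mul_of_nonneg_left ?_ (binomialWeight_nonneg p G)
        exact abs_sub_le_two_mul_inv_one_add_sq (coulsonIntegrand_mem G ht)
          (one_sub_mul_semicircleStieltjes_mem hv (mul_one_sub_le_one p) ht)
    _ = _ := by rw [← Finset.sum_mul, sum_binomialWeight, one_mul]

theorem measurable_meanCoulsonGap : Measurable (meanCoulsonGap V p) := by
  unfold meanCoulsonGap coulsonIntegrand semicircleStieltjes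
  fun_prop

theorem meanCoulsonGap_sq_le [Nonempty V] (hv : 0 < (p * (1 - p) : ℝ)) {t : ℝ} (ht : 0 < t) :
    meanCoulsonGap V p t ^ 2 ≤ ∑ G : SimpleGraph V, binomialWeight p G *
      ‖semicircleDefect (p * (1 - p)) t (graphStieltjes t G)‖ ^ 2 := by
  have h : meanCoulsonGap V p t ≤ ∑ G : SimpleGraph V, binomialWeight p G *
      ‖semicircleDefect (p * (1 - p)) t (graphStieltjes t G)‖ := by
    refine Finset.sum_le_sum fun G _ => ?_
    refine mul_le_mul_of_nonneg_left ?_ (binomialWeight_nonneg p G)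
    -- Stability needs the upper half plane; the sign follows from the Coulson integrand being at
    -- most 1.
    have him : 0 ≤ (graphStieltjes t G).im := by
      have h1 := (coulsonIntegrand_mem G ht).2.1
      rw [coulsonIntegrand_eq G ht] at h1
      exact nonneg_of_mul_nonneg_right (by linarith) ht
    have := abs_im_sub_semicircleStieltjes_le hv ht him
    rw [abs_sub_comm] at this
    rw [coulsonIntegrand_eq G ht, sub_sub_sub_cancel_left]
    simpa using this
  refine (pow_le_pow_left₀ (meanCoulsonGap_nonneg p t) h 2).trans ?_
  -- Cauchy–Schwarz for weights of total mass 1.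
  have := Finset.sum_sq_le_sum_mul_sum_of_sq_le_mul (Finset.univ : Finset (SimpleGraph V))
    (r := fun G => binomialWeight p G *
      ‖semicircleDefect (p * (1 - p)) t (graphStieltjes t G)‖)
    (f := fun G => binomialWeight p G) (g := fun G => binomialWeight p G *
      ‖semicircleDefect (p * (1 - p)) t (graphStieltjes t G)‖ ^ 2)
    (fun G _ => binomialWeight_nonneg p G)
    (fun G _ => mul_nonneg (binomialWeight_nonneg p G) (by positivity))
    (fun G _ => le_of_eq (by ring))
  rwa [sum_binomialWeight, one_mul] at this

theorem tendsto_meanCoulsonGap (hv : 0 < (p * (1 - p) : ℝ)) {t : ℝ} (ht : 0 < t) :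
    Tendsto (fun n : ℕ => meanCoulsonGap (Fin n) p t) atTop (𝓝 0) := by
  obtain ⟨C, hC⟩ := exists_sum_binomialWeight_defect_le p ht
  have hlim : Tendsto (fun n : ℕ => C * (√(n : ℝ))⁻¹) atTop (𝓝 0) := by
    have := (Real.tendsto_sqrt_atTop.comp tendsto_natCast_atTop_atTop).inv_tendsto_atTop.const_mul C
    simpa using this
  have hsq : Tendsto (fun n : ℕ => meanCoulsonGap (Fin n) p t ^ 2) atTop (𝓝 0) := by
    refine squeeze_zero' (Eventually.of_forall fun n => by positivity) ?_ hlim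
    filter_upwards [eventually_gt_atTop 0] with n hn
    have : Nonempty (Fin n) := ⟨⟨0, hn⟩⟩
    refine (meanCoulsonGap_sq_le p hv ht).trans ?_
    simpa using hC (Fin n)
  have := hsq.sqrt
  simpa [Real.sqrt_sq (meanCoulsonGap_nonneg p t)] using this

theorem tendsto_integral_meanCoulsonGap (hv : 0 < (p * (1 - p) : ℝ)) :
    Tendsto (fun n : ℕ => ∫ t in Ioi (0 : ℝ), meanCoulsonGap (Fin n) p t) atTop (𝓝 0) := by
  have h := tendsto_integral_of_dominated_convergence (μ := volume.restrict (Ioi (0 : ℝ)))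
    (F := fun n : ℕ => meanCoulsonGap (Fin n) p) (f := fun _ => (0 : ℝ))
    (fun t => 2 * (1 + t ^ 2)⁻¹)
    (fun n => (measurable_meanCoulsonGap p).aestronglyMeasurable)
    ((integrable_inv_one_add_sq.const_mul 2).integrableOn)
    (fun n => (ae_restrict_mem measurableSet_Ioi).mono fun t ht => by
      rw [Real.norm_of_nonneg (meanCoulsonGap_nonneg p t)]
      exact meanCoulsonGap_le p hv ht)
    ((ae_restrict_mem measurableSet_Ioi).mono fun t ht => tendsto_meanCoulsonGap p hv ht)
  simpa using h

theorem abs_graphEnergy_sub_le (hv : 0 < (p * (1 - p) : ℝ)) (G : SimpleGraph V) :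
    |graphEnergy G / (Fintype.card V * √(Fintype.card V)) -
        8 / (3 * Real.pi) * √(p * (1 - p))| ≤
      2 / Real.pi * ∫ t in Ioi (0 : ℝ),
        |coulsonIntegrand G t - (1 - t * semicircleStieltjes (p * (1 - p)) t)| := by
  obtain ⟨h1, h2⟩ := coulsonIntegrand_integral G
  obtain ⟨h3, h4⟩ := semicircle_integral hv
  have hpi := Real.pi_pos
  have h5 := integral_sub h1 h3
  rw [h2, h4] at h5
  have e : graphEnergy G / (Fintype.card V * √(Fintype.card V)) -
      8 / (3 * Real.pi) * √(p * (1 - p)) = 2 / Real.pi * ∫ t in Ioi (0 : ℝ),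
        (coulsonIntegrand G t - (1 - t * semicircleStieltjes (p * (1 - p)) t)) := by
    rw [h5]
    generalize graphEnergy G / (Fintype.card V * √(Fintype.card V)) = E
    field_simp
    ring
  rw [e, abs_mul, abs_of_pos (by positivity)]
  gcongr
  exact abs_integral_le_integral_abs

theorem sum_binomialWeight_abs_graphEnergy_sub_le (hv : 0 < (p * (1 - p) : ℝ)) :
    ∑ G : SimpleGraph V, binomialWeight p G *
        |graphEnergy G / (Fintype.card V * √(Fintype.card V)) -
          8 / (3 * Real.pi) * √(p * (1 - p))| ≤
      2 / Real.pi * ∫ t in Ioi (0 : ℝ), meanCoulsonGap V p t := by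
  have hint : ∀ G : SimpleGraph V, IntegrableOn (fun t => binomialWeight p G *
      |coulsonIntegrand G t - (1 - t * semicircleStieltjes (p * (1 - p)) t)|) (Ioi 0) := fun G =>
    (((coulsonIntegrand_integral G).1.sub (semicircle_integral hv).1).abs).const_mul _
  simp only [meanCoulsonGap]
  rw [integral_finsetSum _ fun G _ => hint G, Finset.mul_sum]
  refine Finset.sum_le_sum fun G _ => ?_
  rw [integral_const_mul, mul_left_comm]
  exact mul_le_mul_of_nonneg_left (abs_graphEnergy_sub_le p hv G) (binomialWeight_nonneg p G)

theorem natCast_rpow_three_halves (n : ℕ) : (n : ℝ) ^ (3 / 2 : ℝ) = n * √n := by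
  rcases Nat.eq_zero_or_pos n with rfl | hn
  · norm_num
  · rw [show (3 / 2 : ℝ) = 1 + 1 / 2 by norm_num, Real.rpow_add (by exact_mod_cast hn),
      Real.rpow_one, Real.sqrt_eq_rpow]

/-- Markov's inequality. -/
theorem binomialRandom_real_graphEnergy_deviation_le (hv : 0 < (p * (1 - p) : ℝ)) {ε : ℝ}
    (hε : 0 < ε) :
    (binomialRandom V p).real {G | ε < |graphEnergy G / (Fintype.card V * √(Fintype.card V)) -
        8 / (3 * Real.pi) * √(p * (1 - p))|} ≤
      (2 / Real.pi * ∫ t in Ioi (0 : ℝ), meanCoulsonGap V p t) / ε := by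
  refine (binomialRandom_real_le_sum p _ (fun G => |graphEnergy G /
    (Fintype.card V * √(Fintype.card V)) - 8 / (3 * Real.pi) * √(p * (1 - p))| / ε)
    (fun G => by positivity) (fun G hG => ?_)).trans ?_
  · rw [le_div_iff₀ hε, one_mul]
    exact le_of_lt hG
  · simp only [← mul_div_assoc]
    rw [← Finset.sum_div]
    gcongr
    simpa only [mul_div_assoc] using sum_binomialWeight_abs_graphEnergy_sub_le p hv

end Convergence

/-! ### Transfer to the reverse Wiener energy. -/

theorem corollary3p5 (p : unitInterval) (hp0 : 0 < (p : ℝ)) (hp1 : (p : ℝ) < 1)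
    (ε : ℝ) (hε : 0 < ε) :
    Filter.Tendsto
      (fun n : ℕ => SimpleGraph.binomialRandom (Fin n) p
        {G : SimpleGraph (Fin n) | G.Connected ∧
          |reverseWienerEnergy G
              - 8 / (3 * Real.pi) * Real.sqrt ((p : ℝ) * (1 - (p : ℝ))) * (n : ℝ) ^ (3 / 2 : ℝ)|
            ≤ ε * (n : ℝ) ^ (3 / 2 : ℝ)})
      Filter.atTop (nhds 1) := by
  have hv : 0 < ((p : ℝ) * (1 - p)) := mul_pos hp0 (by linarith)
  set S : ∀ n : ℕ, Set (SimpleGraph (Fin n)) := fun n => {G | G.Connected ∧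
    |reverseWienerEnergy G
        - 8 / (3 * Real.pi) * Real.sqrt ((p : ℝ) * (1 - (p : ℝ))) * (n : ℝ) ^ (3 / 2 : ℝ)|
      ≤ ε * (n : ℝ) ^ (3 / 2 : ℝ)} with hS
  set b : ℕ → ℝ := fun n =>
    (SimpleGraph.binomialRandom (Fin n) p).real {G | ¬ HasDiameterTwo G} +
      (2 / Real.pi * ∫ t in Set.Ioi (0 : ℝ), meanCoulsonGap (Fin n) p t) / ε with hb
  have hblim : Filter.Tendsto b Filter.atTop (nhds 0) := by
    have h1 := tendsto_binomialRandom_real_not_hasDiameterTwo p hp0 hp1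
    have h2 := ((tendsto_integral_meanCoulsonGap p hv).const_mul (2 / Real.pi)).div_const ε
    simpa using h1.add h2
  -- Positivity of `n` allows division by `n * √n`, the normalization of the energy.
  have hcompl : ∀ n : ℕ, 0 < n → (SimpleGraph.binomialRandom (Fin n) p).real (S n)ᶜ ≤ b n := by
    intro n hn
    have hn' : (0 : ℝ) < n := by exact_mod_cast hn
    have hpos : (0 : ℝ) < n * √n := mul_pos hn' (Real.sqrt_pos.2 hn')
    have hsub : (S n)ᶜ ⊆ {G | ¬ HasDiameterTwo G} ∪
        {G | ε < |graphEnergy G / (Fintype.card (Fin n) * √(Fintype.card (Fin n))) -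
          8 / (3 * Real.pi) * √(p * (1 - p))|} := by
      intro G hG
      by_cases hd : HasDiameterTwo G
      · right
        by_contra hle
        refine hG ⟨hd.connected, ?_⟩
        simp only [Set.mem_ofPred_eq, not_lt, Fintype.card_fin] at hle
        rw [hd.reverseWienerEnergy_eq, natCast_rpow_three_halves]
        have e : graphEnergy G - 8 / (3 * Real.pi) * √(p * (1 - p)) * (n * √n) =
            (graphEnergy G / (n * √n) - 8 / (3 * Real.pi) * √(p * (1 - p))) * (n * √n) := by
          rw [sub_mul, div_mul_cancel₀ _ hpos.ne']
        rw [e, abs_mul, abs_of_pos hpos]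
        exact mul_le_mul_of_nonneg_right hle hpos.le
      · exact Or.inl hd
    refine (MeasureTheory.measureReal_mono hsub).trans ?_
    refine (MeasureTheory.measureReal_union_le _ _).trans ?_
    exact add_le_add le_rfl (binomialRandom_real_graphEnergy_deviation_le p hv hε)
  have hreal : Filter.Tendsto (fun n => (SimpleGraph.binomialRandom (Fin n) p).real (S n))
      Filter.atTop (nhds 1) := by
    have hc : Filter.Tendsto (fun n => (SimpleGraph.binomialRandom (Fin n) p).real (S n)ᶜ)
        Filter.atTop (nhds 0) := by
      refine squeeze_zero' (Filter.Eventually.of_forall fun n =>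
        MeasureTheory.measureReal_nonneg) ?_ hblim
      filter_upwards [Filter.eventually_gt_atTop 0] with n hn using hcompl n hn
    have h := hc.const_sub 1
    rw [sub_zero] at h
    refine h.congr fun n => ?_
    rw [MeasureTheory.probReal_compl_eq_one_sub (Set.toFinite _).measurableSet, sub_sub_cancel]
  have h := (ENNReal.continuous_ofReal.tendsto 1).comp hreal
  rw [ENNReal.ofReal_one] at h
  refine h.congr fun n => ?_
  simp [S]
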